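/- **Setting.** Let $E,F$ be standard Borel spaces with $\sigma$-finite reference measures $\mu,\nu$ (for example $\mathbb R^{n_x},\mathbb R^{n_y}$ with Lebesgue measure restricted to measurable sets $\mathcal X,\mathcal Y$). $(X_0,Y_0)$ has a density $p_{x_0,y_0}$ with respect to $\mu\otimes\nu$; given the past, $X_{k+1}$ and $Y_{k+1}$ are independent with densities $p(x_{k+1}\mid X_k,Y_k)$ and $p(y_{k+1}\mid Y_k)$. At each time $k=0,\dots,K$ a sampler draws $N_k\in\{0,1\}$ from $\pi_k(\cdot\mid Z^{k-1},X_k,M_k)$, where $Z_k=X_k$ if $N_k=1$, $Z_k=\emptyset$ if $N_k=0$, $Z^{k-1}=(Z_0,\dots,Z_{k-1})$, and the local memory $M_k$ is the record of the samples discarded before time $k$; an adversary then draws a reconstruction $\tilde X_k$ from $\tilde\pi_k(\cdot\mid Z^k,\tilde X^{k-1})$. All $\pi_k,\tilde\pi_k$ are Markov kernels. For a measurable distortion $l_D\ge 0$ with $l_D(x,x)=0$ and a constant $\lambda>0$, the objective is $$L(\pi,\tilde\pi)=\sum_{k=0}^K\mathsf E[l_D(X_k,\tilde X_k)]+\lambda\,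 I(Z^K;Y^K)\in[0,\infty].$$ **Bellman equation.** A policy collection at time $k$ is a Markov kernel $\mathcal A_k=\{a_k(n\mid x,m)\}$ from pairs $(x_k,m_k)$ to $\{0,1\}$. A belief state $b_k(x_k,m_k,y^k)$ is a probability density (for the product reference measure) under which it is known at which of the times $0,\dots,k-1$ a sample was discarded. When $(X_k,M_k,Y^k)$ has density $b_k$ and $N_k$ is drawn from $a_k$, the law of $Z_k$ has mass $c(\emptyset)=\int a_k(0\mid x,m)\,b_k(x,m,y)$ at $\emptyset$ and density $c(x)=\int a_k(1\mid x,m)\,b_k(x,m,y)\,dm\,dy$ on $E$. The updated belief $\Phi(b_k,\mathcal A_k,Z_k)$ is $$b_{k+1}(x_{k+1},m_{k+1},y^{k+1})=\begin{cases}\dfrac{p(x_{k+1}\mid x_k,y_k)\,p(y_{k+1}\mid y_k)\,b_k(x_k,m_k,y^k)\,a_k(0\mid x_k,m_k)}{c(\emptyset)},& Z_k=\emptyset,\ m_{k+1}=(m_k,x_k),\\[2mm]\dfrac{p(x_{k+1}\mid X_k,y_k)\,p(y_{k+1}\mid y_k)\,b_k(X_k,m_k,y^k)\,a_k(1\mid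 X_k,m_k)}{c(X_k)},& Z_k=X_k,\ m_{k+1}=m_k.\end{cases}$$ Let $V^\star_{K+1}=0$ and, for $k\le K$, $$V_k^\star(b_k)=\inf_{\mathcal A_k}\Big\{\inf_{v\in E}\tilde l_D(\mathcal A_k,b_k,v)+\lambda\, l_I(\mathcal A_k,b_k)+\mathsf E\big[V_{k+1}^\star(\Phi(b_k,\mathcal A_k,Z_k))\big]\Big\},\qquad(\ast)$$ where $\tilde l_D(\mathcal A_k,b_k,v)=\int a_k(0\mid x,m)\,b_k(x,m,y)\,l_D(x,v)$, $l_I(\mathcal A_k,b_k)=\mathsf E\big[\log\frac{p(Y^k\mid Z^k)}{p(Y^k\mid Z^{k-1})}\,\big|\,Z^{k-1}\big]$, i.e. the expectation over $Z_k$ of the Kullback–Leibler divergence of the posterior of $Y^k$ given $Z_k$ from the $y$-marginal of $b_k$. **Theorem.** For every $k\le K$ and every belief state $b_k$ let $\mathcal A_k^\star(b_k)$ attain the infimum in $(\ast)$. Put $b_0=p_{x_0,y_0}$ and $b_{k+1}=\Phi(b_k,\mathcal A^\star_k(b_k),Z_k)$, so that $b_k$ is determined by the shared data $Z^{k-1}$,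 and define the two-step sampling policy $$\pi_k^\star(N_k\mid Z^{k-1},X_k,M_k)=a_k^\star(N_k\mid X_k,M_k),\qquad a_k^\star\in\mathcal A_k^\star(b_k):$$ first select the collection $\mathcal A^\star_k(b_k)$ from the belief induced by $Z^{k-1}$, then apply $a^\star_k$ to the local state and memory. Assume that $\pi^\star$ is measurable, and let $\tilde\pi^\star$ be a measurable optimal reconstruction for it: $\tilde X_k=Z_k$ if $N_k=1$, and if $N_k=0$ then $\tilde X_k$ is a minimizer of $v\mapsto\tilde l_D(\mathcal A_k^\star(b_k),b_k,v)$. Then: 1. $\pi^\star$ is an optimal sampling policy: $L(\pi^\star,\tilde\pi^\star)\le L(\pi,\tilde\pi)$ for all sampling policies $\pi$ and all reconstruction policies $\tilde\pi$. 2. For every $k\le K$, $b_k$ is the belief state associated with $Z^{k-1}$ under $\pi^\star$: it is the conditional density of $(X_k,M_k,Y^k)$ given $Z^{k-1}$. -/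

import Mathlib

open MeasureTheory ProbabilityTheory
open scoped ENNReal NNReal

noncomputable section

namespace PrivacySampling

variable {E F : Type*} [MeasurableSpace E] [MeasurableSpace F]

/-! ## Samples, data, memory -/

/-- One output of the sampler: `Sum.inl x` when the state `x` is retained, and the blank symbol
`Sum.inr ()` when it is discarded. -/
abbrev Sample (E : Type*) := E ⊕ Unit

/-- The shared data `Z^{k-1} = (Z_0, …, Z_{k-1})`. -/
abbrev Data (E : Type*) (k : ℕ) := Fin k → Sample E

/-- The local memory `M_k`: entry `i` is `Sum.inl X_i` if `X_i` was discarded,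
and the blank `Sum.inr ()` if it was retained. -/
abbrev Memory (E : Type*) (k : ℕ) := Fin k → Sample E

/-- The sampler's output for the state `x` and the decision `n` (`true` = retain). -/
def sampleOut (x : E) (n : Bool) : Sample E :=
  if n then Sum.inl x else Sum.inr ()

/-- What is added to the local memory: `x` if it is discarded, nothing otherwise. -/
def memoryOut (x : E) (n : Bool) : Sample E :=
  if n then Sum.inr () else Sum.inl x

lemma measurable_sampleOut : Measurable fun p : E × Bool => sampleOut p.1 p.2 := by
  refine measurable_from_prod_countable_left fun n => ?_
  cases n
  · exact measurable_const
  · exact measurable_inl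

lemma measurable_memoryOut : Measurable fun p : E × Bool => memoryOut p.1 p.2 := by
  refine measurable_from_prod_countable_left fun n => ?_
  cases n
  · exact measurable_inl
  · exact measurable_const

lemma measurable_snoc {A : Type*} [MeasurableSpace A] (k : ℕ) :
    Measurable fun p : (Fin k → A) × A => (Fin.snoc p.1 p.2 : Fin (k + 1) → A) := by
  refine measurable_pi_lambda _ fun i => ?_
  refine Fin.lastCases ?_ (fun j => ?_) i
  · simpa using measurable_snd
  · simp only [Fin.snoc_castSucc]
    fun_prop

/-! ## The model -/

/-- The data of the problem: reference measures for the densities (Lebesgue measure in the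
Euclidean case), the initial density of `(X_0, Y_0)`, the transition densities
`p(x_{k+1} | x_k, y_k)` and `p(y_{k+1} | y_k)`, the distortion measure `l_D`, the weight `λ > 0` of
the privacy term, and the horizon `K`. -/
structure Model (E F : Type*) [MeasurableSpace E] [MeasurableSpace F] where
  refX : Measure E
  refY : Measure F
  sigmaFinite_refX : SigmaFinite refX
  sigmaFinite_refY : SigmaFinite refY
  initDensity : E × F → ℝ≥0∞
  measurable_initDensity : Measurable initDensity
  lintegral_initDensity : ∫⁻ w, initDensity w ∂(refX.prod refY) = 1
  stateDensity : E × F → E → ℝ≥0∞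
  measurable_stateDensity : Measurable (Function.uncurry stateDensity)
  lintegral_stateDensity : ∀ w, ∫⁻ x, stateDensity w x ∂refX = 1
  privDensity : F → F → ℝ≥0∞
  measurable_privDensity : Measurable (Function.uncurry privDensity)
  lintegral_privDensity : ∀ y, ∫⁻ y', privDensity y y' ∂refY = 1
  distortion : E → E → ℝ≥0
  measurable_distortion : Measurable (Function.uncurry distortion)
  distortion_self : ∀ x, distortion x x = 0
  weight : ℝ≥0
  weight_pos : 0 < weight
  horizon : ℕ

attribute [instance] Model.sigmaFinite_refX Model.sigmaFinite_refY

/-! ## Sampling and reconstruction policies -/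

/-- A sampling policy `π_k(N_k | Z^{k-1}, X_k, M_k)`, `k = 0, 1, …`. -/
structure SamplingPolicy (E : Type*) [MeasurableSpace E] where
  kernel : ∀ k : ℕ, Kernel (Data E k × E × Memory E k) Bool
  markov : ∀ k, IsMarkovKernel (kernel k)

/-- A (randomized) reconstruction policy `π̃_k(X̃_k | Z^k, X̃^{k-1})`, `k = 0, 1, …`. -/
structure ReconPolicy (E : Type*) [MeasurableSpace E] where
  kernel : ∀ k : ℕ, Kernel (Data E (k + 1) × (Fin k → E)) E
  markov : ∀ k, IsMarkovKernel (kernel k)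

/-- The reconstruction policy given by the measurable functions `X̃_k = g_k(Z^k)`. -/
def ReconPolicy.ofFun (g : ∀ k : ℕ, Data E (k + 1) → E) (hg : ∀ k, Measurable (g k)) :
    ReconPolicy E where
  kernel k := Kernel.deterministic (fun i => g k i.1) ((hg k).comp measurable_fst)
  markov _ := inferInstance

/-! ## The closed loop and the design objective -/

/-- What happens at one time step: state, private input, decision, reconstruction,
`(((X_k, Y_k), N_k), X̃_k)`. -/
abbrev Stage (E F : Type*) := ((E × F) × Bool) × E

/-- The shared data along a trajectory. -/
def dataOf {k : ℕ} (h : Fin k → Stage E F) : Data E k :=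
  fun i => sampleOut (h i).1.1.1 (h i).1.2

/-- The local memory along a trajectory. -/
def memoryOf {k : ℕ} (h : Fin k → Stage E F) : Memory E k :=
  fun i => memoryOut (h i).1.1.1 (h i).1.2

/-- The private sequence along a trajectory. -/
def privOf {k : ℕ} (h : Fin k → Stage E F) : Fin k → F :=
  fun i => (h i).1.1.2

/-- The reconstructions along a trajectory. -/
def reconOf {k : ℕ} (h : Fin k → Stage E F) : Fin k → E :=
  fun i => (h i).2

lemma measurable_dataOf {k : ℕ} : Measurable (dataOf : (Fin k → Stage E F) → Data E k) := by
  refine measurable_pi_lambda _ fun i => ?_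
  have h : Measurable fun h : Fin k → Stage E F => ((h i).1.1.1, (h i).1.2) := by fun_prop
  exact measurable_sampleOut.comp h

lemma measurable_memoryOf {k : ℕ} :
    Measurable (memoryOf : (Fin k → Stage E F) → Memory E k) := by
  refine measurable_pi_lambda _ fun i => ?_
  have h : Measurable fun h : Fin k → Stage E F => ((h i).1.1.1, (h i).1.2) := by fun_prop
  exact measurable_memoryOut.comp h

lemma measurable_reconOf {k : ℕ} :
    Measurable (reconOf : (Fin k → Stage E F) → Fin k → E) := by
  unfold reconOf
  fun_prop

/-- The information `(Z^{k-1}, X_k, M_k)` of the sampler at time `k`. -/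
def samplerInfo {k : ℕ} (p : (Fin k → Stage E F) × (E × F)) : Data E k × E × Memory E k :=
  (dataOf p.1, p.2.1, memoryOf p.1)

/-- The information `(Z^k, X̃^{k-1})` of the adversary at time `k`. -/
def reconInfo {k : ℕ} (p : (Fin k → Stage E F) × ((E × F) × Bool)) :
    Data E (k + 1) × (Fin k → E) :=
  (Fin.snoc (dataOf p.1) (sampleOut p.2.1.1 p.2.2), reconOf p.1)

lemma measurable_samplerInfo {k : ℕ} :
    Measurable (samplerInfo : (Fin k → Stage E F) × (E × F) → _) :=
  (measurable_dataOf.comp measurable_fst).prodMk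
    ((measurable_fst.comp measurable_snd).prodMk (measurable_memoryOf.comp measurable_fst))

lemma measurable_reconInfo {k : ℕ} :
    Measurable (reconInfo : (Fin k → Stage E F) × ((E × F) × Bool) → _) := by
  have h : Measurable fun p : (Fin k → Stage E F) × ((E × F) × Bool) => (p.2.1.1, p.2.2) := by
    fun_prop
  exact ((measurable_snoc k).comp ((measurable_dataOf.comp measurable_fst).prodMk
    (measurable_sampleOut.comp h))).prodMk (measurable_reconOf.comp measurable_fst)

namespace Model

variable (P : Model E F)

/-- The law of `(X_k, Y_k)` given the past: `(X_0, Y_0)` has the initial density; given the past,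
`X_{k+1}` and `Y_{k+1}` are drawn independently from `p(· | X_k, Y_k)` and `p(· | Y_k)`. -/
def envKernel : ∀ k : ℕ, Kernel (Fin k → Stage E F) (E × F)
  | 0 => Kernel.const _ ((P.refX.prod P.refY).withDensity P.initDensity)
  | k + 1 => Kernel.withDensity (Kernel.const _ (P.refX.prod P.refY)) fun h w =>
      P.stateDensity (h (Fin.last k)).1.1 w.1 * P.privDensity (h (Fin.last k)).1.1.2 w.2

/-- One time step of the closed loop: nature draws `(X_k, Y_k)`, the sampler draws `N_k`, and the
adversary draws `X̃_k`. -/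
def stepKernel (π : SamplingPolicy E) (ρ : ReconPolicy E) (k : ℕ) :
    Kernel (Fin k → Stage E F) (Stage E F) :=
  Kernel.compProd
    (Kernel.compProd (P.envKernel k) ((π.kernel k).comap samplerInfo measurable_samplerInfo))
    ((ρ.kernel k).comap reconInfo measurable_reconInfo)

/-- The law of the first `k` stages (times `0, …, k - 1`) of the closed loop. -/
def law (π : SamplingPolicy E) (ρ : ReconPolicy E) : ∀ k : ℕ, Measure (Fin k → Stage E F)
  | 0 => Measure.dirac fun i => i.elim0
  | k + 1 => (Measure.compProd (law π ρ k) (P.stepKernel π ρ k)).map fun p => Fin.snoc p.1 p.2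

/-- Mutual information of the two components of a random pair with law `m`. -/
def mutualInfo {A B : Type*} [MeasurableSpace A] [MeasurableSpace B] (m : Measure (A × B)) :
    ℝ≥0∞ :=
  InformationTheory.klDiv m (m.fst.prod m.snd)

/-- The design objective `L(π, π̃) = ∑_{k ≤ K} E[l_D(X_k, X̃_k)] + λ I(Z^K; Y^K)`. -/
def objective (π : SamplingPolicy E) (ρ : ReconPolicy E) : ℝ≥0∞ :=
  (∑ k : Fin (P.horizon + 1),
      ∫⁻ h, P.distortion (h k).1.1.1 (h k).2 ∂(P.law π ρ (P.horizon + 1)))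
    + P.weight * mutualInfo
        ((P.law π ρ (P.horizon + 1)).map fun h => (dataOf h, privOf h))

end Model

/-! ## Belief states -/

/-- The arguments `(x_k, m_k, y^k)` of a belief state. -/
abbrev BeliefPoint (E F : Type*) (k : ℕ) := E × Memory E k × (Fin (k + 1) → F)

/-- A belief state `b_k(x_k, m_k, y^k)`, a density with respect to `Model.refBelief`. -/
abbrev Belief (E F : Type*) (k : ℕ) := BeliefPoint E F k → ℝ≥0∞

/-- A policy collection `𝒜_k = {a_k(n | x, m)}`: for all `(x, m)` a mass distribution of `N_k`. -/
structure Collection (E : Type*) [MeasurableSpace E] (k : ℕ) where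
  kernel : Kernel (E × Memory E k) Bool
  markov : IsMarkovKernel kernel

/-- The probability `a_k(n | x, m)`. -/
def Collection.prob {k : ℕ} (a : Collection E k) (n : Bool) (x : E) (m : Memory E k) : ℝ≥0∞ :=
  a.kernel (x, m) {n}

namespace Model

variable (P : Model E F)

/-- Reference measure for one sample: `refX` on states, unit mass on the blank. -/
def refSample : Measure (Sample E) :=
  P.refX.map Sum.inl + Measure.dirac (Sum.inr ())

/-- Reference measure for the memory. -/
def refMemory (k : ℕ) : Measure (Memory E k) :=
  Measure.pi fun _ => P.refSample

/-- Reference measure for the private sequence `y^k`. -/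
def refPriv (k : ℕ) : Measure (Fin (k + 1) → F) :=
  Measure.pi fun _ => P.refY

/-- Reference measure for `(x_k, m_k, y^k)`. -/
def refBelief (k : ℕ) : Measure (BeliefPoint E F k) :=
  P.refX.prod ((P.refMemory k).prod (P.refPriv k))

/-- The belief states at time `k`: probability densities for which it is known at which of
the times `0, …, k - 1` a sample was discarded. -/
def IsBelief {k : ℕ} (b : Belief E F k) : Prop :=
  Measurable b ∧ ∫⁻ q, b q ∂(P.refBelief k) = 1 ∧
    ∃ D : Set (Fin k), ∀ q, b q ≠ 0 → ∀ i, (q.2.1 i).isLeft = true ↔ i ∈ D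

/-- The initial belief state is the density of `(X_0, Y_0)`. -/
def initBelief : Belief E F 0 :=
  fun q => P.initDensity (q.1, q.2.2 0)

/-- The density of `Z_k` (with respect to `refSample`) when `(X_k, M_k, Y^k)` has density `b` and
`N_k` is drawn from `a`; at the blank it is the probability of `N_k = 0`. -/
def outDensity {k : ℕ} (b : Belief E F k) (a : Collection E k) : Sample E → ℝ≥0∞
  | Sum.inr _ => ∫⁻ q, a.prob false q.1 q.2.1 * b q ∂(P.refBelief k)
  | Sum.inl x => ∫⁻ r, a.prob true x r.1 * b (x, r) ∂((P.refMemory k).prod (P.refPriv k))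

/-- The law of `Z_k` when `(X_k, M_k, Y^k)` has density `b` and `N_k` is drawn from `a`. -/
def outLaw {k : ℕ} (b : Belief E F k) (a : Collection E k) : Measure (Sample E) :=
  P.refSample.withDensity (P.outDensity b a)

/-- The belief update `b_{k+1} = Φ(b_k, 𝒜_k, Z_k)`. A discarded state moves to the last entry
of the memory. -/
def update {k : ℕ} (b : Belief E F k) (a : Collection E k) (z : Sample E) : Belief E F (k + 1) :=
  fun q =>
    let m : Memory E k := Fin.init q.2.1
    let y : Fin (k + 1) → F := Fin.init q.2.2
    let trans : E → ℝ≥0∞ := fun x =>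
      P.stateDensity (x, y (Fin.last k)) q.1
        * P.privDensity (y (Fin.last k)) (q.2.2 (Fin.last (k + 1)))
    match z, q.2.1 (Fin.last k) with
    | Sum.inr _, Sum.inl x => trans x * b (x, m, y) * a.prob false x m / P.outDensity b a z
    | Sum.inl x, Sum.inr _ => trans x * b (x, m, y) * a.prob true x m / P.outDensity b a z
    | _, _ => 0

/-- The law of `Y^k` given `Z^{k-1}`, i.e. the `y`-marginal of `b`. -/
def priorPriv {k : ℕ} (b : Belief E F k) : Measure (Fin (k + 1) → F) :=
  (P.refPriv k).withDensity fun y =>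
    ∫⁻ r : E × Memory E k, b (r.1, r.2, y) ∂(P.refX.prod (P.refMemory k))

/-- The law of `Y^k` given `Z^k`, where `Z_k = z`. -/
def posteriorPriv {k : ℕ} (b : Belief E F k) (a : Collection E k) (z : Sample E) :
    Measure (Fin (k + 1) → F) :=
  (P.refPriv k).withDensity fun y =>
    match z with
    | Sum.inr _ =>
        (∫⁻ r : E × Memory E k, a.prob false r.1 r.2 * b (r.1, r.2, y)
          ∂(P.refX.prod (P.refMemory k))) / P.outDensity b a z
    | Sum.inl x =>
        (∫⁻ m, a.prob true x m * b (x, m, y) ∂(P.refMemory k)) / P.outDensity b a z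

/-! ## The Bellman equation -/

/-- `l̃_D(𝒜_k, b_k, v)`: the expected reconstruction error when a discarded state is
reconstructed as `v`. -/
def distLoss {k : ℕ} (b : Belief E F k) (a : Collection E k) (v : E) : ℝ≥0∞ :=
  ∫⁻ q, P.distortion q.1 v * (a.prob false q.1 q.2.1 * b q) ∂(P.refBelief k)

/-- `l_I(𝒜_k, b_k) = E[log (p(Y^k | Z^k) / p(Y^k | Z^{k-1})) | Z^{k-1}]`: the conditional expectation
given `Z^k` of the logarithm is a Kullback–Leibler divergence, which is then averaged
over `Z_k`. -/
def infoLoss {k : ℕ} (b : Belief E F k) (a : Collection E k) : ℝ≥0∞ :=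
  ∫⁻ z, InformationTheory.klDiv (P.posteriorPriv b a z) (P.priorPriv b) ∂(P.outLaw b a)

/-- The expression minimized in the Bellman equation, for the next cost-to-go `V`:
`l̃_D(𝒜, b, π̃⋆) + λ l_I(𝒜, b) + E[V(Φ(b, 𝒜, Z_k)) | Z^{k-1}]`, where `π̃⋆` is the optimal
reconstruction. -/
def bellmanObjective {k : ℕ} (V : Belief E F (k + 1) → ℝ≥0∞) (b : Belief E F k)
    (a : Collection E k) : ℝ≥0∞ :=
  (⨅ v : E, P.distLoss b a v) + P.weight * P.infoLoss b a
    + ∫⁻ z, V (P.update b a z) ∂(P.outLaw b a)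

/-- Optimal cost-to-go at time `k` when `t` decisions remain. -/
def costToGo : ∀ (_t k : ℕ), Belief E F k → ℝ≥0∞
  | 0, _, _ => 0
  | t + 1, k, b => ⨅ a : Collection E k, P.bellmanObjective (costToGo t (k + 1)) b a

/-- The optimal cost-to-go function `V⋆_k`. -/
def value (k : ℕ) (b : Belief E F k) : ℝ≥0∞ :=
  P.costToGo (P.horizon + 1 - k) k b

/-- The terminal condition `V⋆_{K+1} = 0`. -/
lemma value_terminal (b : Belief E F (P.horizon + 1)) : P.value (P.horizon + 1) b = 0 := by
  simp [value, costToGo]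

/-- The Bellman equation. -/
lemma value_eq_iInf {k : ℕ} (hk : k ≤ P.horizon) (b : Belief E F k) :
    P.value k b = ⨅ a : Collection E k, P.bellmanObjective (P.value (k + 1)) b a := by
  have h : P.horizon + 1 - k = (P.horizon + 1 - (k + 1)) + 1 := by omega
  unfold value
  rw [h]
  rfl

/-- `S` assigns to each belief state `b_k`, `k ≤ K`, a minimizer `𝒜⋆_k(b_k)` of the Bellman
equation. -/
def IsBellmanSolution (S : ∀ k, Belief E F k → Collection E k) : Prop :=
  ∀ k ≤ P.horizon, ∀ b : Belief E F k, P.IsBelief b → ∀ a : Collection E k,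
    P.bellmanObjective (P.value (k + 1)) b (S k b) ≤ P.bellmanObjective (P.value (k + 1)) b a

/-! ## The two-step sampling policy -/

/-- The belief state `b_k` associated with the data `z = Z^{k-1}` when the collections are selected
by `S`: `b_0` is the initial density and `b_{k+1} = Φ(b_k, S_k(b_k), Z_k)`. -/
def beliefOf (S : ∀ k, Belief E F k → Collection E k) : ∀ k : ℕ, Data E k → Belief E F k
  | 0, _ => P.initBelief
  | k + 1, z =>
      let b : Belief E F k := beliefOf S k (Fin.init z)
      P.update b (S k b) (z (Fin.last k))

/-- The two-step rule `(Z^{k-1}, X_k, M_k) ↦ a_k(· | X_k, M_k)`, `a_k ∈ S_k(b_k)`,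
is measurable, as any sampling policy has to be. -/
def IsMeasurableSelection (S : ∀ k, Belief E F k → Collection E k) : Prop :=
  ∀ k, Measurable fun i : Data E k × E × Memory E k => (S k (P.beliefOf S k i.1)).kernel i.2

/-- The two-step sampling policy: select the collection `S_k(b_k)` from the belief state `b_k` of
the shared data `Z^{k-1}`, then draw `N_k` from `a_k(· | X_k, M_k)` in it. -/
def twoStepPolicy (S : ∀ k, Belief E F k → Collection E k) (hS : P.IsMeasurableSelection S) :
    SamplingPolicy E where
  kernel k := ⟨fun i => (S k (P.beliefOf S k i.1)).kernel i.2, hS k⟩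
  markov k := ⟨fun i => (S k (P.beliefOf S k i.1)).markov.isProbabilityMeasure i.2⟩

/-- `g` is an optimal reconstruction for the selection `S`: retained samples are kept, and a
discarded state is reconstructed by a minimizer of the conditional expected distortion. -/
def IsOptimalRecon (S : ∀ k, Belief E F k → Collection E k)
    (g : ∀ k : ℕ, Data E (k + 1) → E) : Prop :=
  ∀ k ≤ P.horizon, ∀ z : Data E k,
    (∀ x : E, g k (Fin.snoc z (Sum.inl x)) = x) ∧
    ∀ v : E,
      P.distLoss (P.beliefOf S k z) (S k (P.beliefOf S k z)) (g k (Fin.snoc z (Sum.inr ()))) ≤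
        P.distLoss (P.beliefOf S k z) (S k (P.beliefOf S k z)) v

/-- In the closed loop of `(π, ρ)`, the family `b z` is the conditional density of
`(X_k, M_k, Y^k)` given `Z^{k-1} = z`. -/
def IsConditionalDensity (π : SamplingPolicy E) (ρ : ReconPolicy E) (k : ℕ)
    (b : Data E k → Belief E F k) : Prop :=
  ∀ (B : Set (Data E k)) (C : Set (BeliefPoint E F k)), MeasurableSet B → MeasurableSet C →
    P.law π ρ (k + 1) {h : Fin (k + 1) → Stage E F |
        dataOf (Fin.init h : Fin k → Stage E F) ∈ B ∧
        ((h (Fin.last k)).1.1.1, memoryOf (Fin.init h : Fin k → Stage E F), privOf h) ∈ C} =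
      ∫⁻ z in B, (∫⁻ q in C, b z q ∂(P.refBelief k)) ∂((P.law π ρ k).map dataOf)

end Model

end PrivacySampling

end

/-! The proof is dynamic programming on the belief state, carried out entirely with integrals in
`[0,∞]`, so that infinite costs need no separate treatment.

A sampling policy `π` is, at each value `z` of the shared data, a policy collection. Starting from
the initial density and updating with these collections gives `policyBelief π k z`. The
reconstruction is drawn from `Z^k` and the earlier reconstructions only, so it carries no further
information on the hidden variables. Hence `policyBelief` is the conditional density of `(X_k, M_k,
Y^k)` given the data and the past reconstructions together, whatever `ρ` is (`isBeliefAt`). The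
inductive step rests on the fact that the update is a disintegration (`lintegral_outLaw_update`).
For the two-step policy `policyBelief` is `beliefOf`, which is the second claim.

The objective must then become a sum of stage costs that depend on the belief. For the distortion
this is conditioning. For the information, the divergence of a mixture splits through its mean
(`lintegral_klInt_eq_add`). Since the posterior of `Y^k` averages to its prior, `I(Z^k;Y^k)` equals
the expected information loss at time `k` plus `I(Z^{k-1};Y^k)`. As `Y_k` depends on the past only
through `Y_{k-1}`, the last term is `I(Z^{k-1};Y^{k-1})` (`priorInfo_succ`), and induction gives the
sum `dataInfo_eq_sum`. So `objective_eq` writes the objective as a recursively defined cost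
`policyCost`.

Backward induction compares `policyCost` with the Bellman recursion. For any pair of policies the
collection in use competes in the infimum, and the reconstruction of a discarded state is drawn
independently of that state given the shared record, so it cannot beat the best constant
(`costToGo_le_policyCost`). For the two-step policy with the optimal reconstruction these losses
vanish (`policyCost_twoStepPolicy_le`). Both bounds meet at `costToGo` of the initial belief.

Normalization by the density of `Z_k` fails on data of probability zero, so statements about beliefs
along the data hold almost surely, with total mass one as the working hypothesis. -/

noncomputable section

namespace PrivacySampling

/-! ### Kullback–Leibler divergence through densities. -/

section Divergence

open InformationTheory

/-- The integrand of the Kullback–Leibler divergence of two densities. -/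
def klInt (p q : ℝ≥0∞) : ℝ≥0∞ := q * ENNReal.ofReal (klFun (p / q).toReal)

lemma measurable_klInt {α : Type*} [MeasurableSpace α] {f g : α → ℝ≥0∞} (hf : Measurable f)
    (hg : Measurable g) : Measurable fun a => klInt (f a) (g a) := by
  unfold klInt
  exact hg.mul (measurable_klFun.comp (hf.div hg).ennreal_toReal).ennreal_ofReal

lemma klInt_zero_right (p : ℝ≥0∞) : klInt p 0 = 0 := by simp [klInt]

lemma klInt_self {p : ℝ≥0∞} (hp : p ≠ ∞) : klInt p p = 0 := by
  rcases eq_or_ne p 0 with rfl | h0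
  · simp [klInt]
  · simp [klInt, ENNReal.div_self h0 hp, klFun_one]

/-- Joint homogeneity of the integrand: a transition density common to both arguments factors out.
It is used in `priorInfo_succ`. -/
lemma klInt_mul_right {p q c : ℝ≥0∞} (hc : c ≠ ∞) : klInt (p * c) (q * c) = klInt p q * c := by
  rcases eq_or_ne c 0 with rfl | h0
  · simp [klInt]
  · rw [klInt, klInt, ENNReal.mul_div_mul_right _ _ h0 hc]
    ring

/-- Finiteness of `p` is not required: `toReal` sends `∞` to `0` consistently on both sides. -/
lemma klInt_eq_ofReal {p q : ℝ≥0∞} (hq : q ≠ ∞) (hq0 : q ≠ 0) :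
    klInt p q = ENNReal.ofReal
      (p.toReal * Real.log (p.toReal / q.toReal) + q.toReal - p.toReal) := by
  have h : 0 < q.toReal := ENNReal.toReal_pos hq0 hq
  rw [klInt, ← ENNReal.ofReal_toReal hq, ← ENNReal.ofReal_mul ENNReal.toReal_nonneg,
    ENNReal.ofReal_toReal hq, ENNReal.toReal_div, klFun]
  congr 1
  field_simp

/-- Since `g` is finite almost everywhere and `f` vanishes where `g` does, `f = g * (f / g)` almost
everywhere. Thus `f / g` is the Radon–Nikodym derivative, and the divergence is the integral of
`klFun` of it. -/
lemma klDiv_withDensity {α : Type*} [MeasurableSpace α] (μ : Measure α) {f g : α → ℝ≥0∞}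
    (hf : Measurable f) (hg : Measurable g) (hfi : ∫⁻ a, f a ∂μ ≠ ∞) (hgi : ∫⁻ a, g a ∂μ ≠ ∞)
    (hfg : ∀ᵐ a ∂μ, g a = 0 → f a = 0) :
    klDiv (μ.withDensity f) (μ.withDensity g) = ∫⁻ a, klInt (f a) (g a) ∂μ := by
  have : IsFiniteMeasure (μ.withDensity f) := isFiniteMeasure_withDensity hfi
  have : IsFiniteMeasure (μ.withDensity g) := isFiniteMeasure_withDensity hgi
  have key : μ.withDensity f = (μ.withDensity g).withDensity (fun a => f a / g a) := by
    have e := withDensity_mul μ hg (hf.div hg)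
    refine Eq.trans ?_ e
    refine withDensity_congr_ae ?_
    filter_upwards [hfg, ae_lt_top hg hgi] with a h1 h2
    rcases eq_or_ne (g a) 0 with h0 | h0
    · simp [h0, h1 h0]
    · simp [ENNReal.mul_div_cancel h0 h2.ne]
  have hac : μ.withDensity f ≪ μ.withDensity g := by
    rw [key]
    exact withDensity_absolutelyContinuous _ _
  have hr : (μ.withDensity f).rnDeriv (μ.withDensity g) =ᵐ[μ.withDensity g]
      fun a => f a / g a := by
    conv_lhs => rw [key]
    exact Measure.rnDeriv_withDensity _ (hf.div hg)
  rw [klDiv_eq_lintegral_klFun_of_ac hac, lintegral_congr_ae (hr.mono fun a ha => by rw [ha]),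
    lintegral_withDensity_eq_lintegral_mul _ hg (by
      exact (measurable_klFun.comp (hf.div hg).ennreal_toReal).ennreal_ofReal)]
  rfl

/-- Neither `f` nor `g` need be integrable, only their difference `L`. The parts of `L` are moved to
the sides where they are nonnegative, and the finite integral of the negative part is cancelled. -/
lemma lintegral_eq_add_of_sub_integrable {α : Type*} [MeasurableSpace α] {μ : Measure α}
    {f g L : α → ℝ} (hf : Measurable f) (hg : Measurable g) (hf0 : ∀ a, 0 ≤ f a)
    (hg0 : ∀ a, 0 ≤ g a) (hL : Integrable L μ) (h : ∀ a, f a = g a + L a) (hL0 : 0 ≤ ∫ a, L a ∂μ) :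
    ∫⁻ a, ENNReal.ofReal (f a) ∂μ =
      ∫⁻ a, ENNReal.ofReal (g a) ∂μ + ENNReal.ofReal (∫ a, L a ∂μ) := by
  have hn : ∫⁻ a, ENNReal.ofReal (-L a) ∂μ ≠ ∞ := hL.neg.lintegral_lt_top.ne
  have hp : ∫⁻ a, ENNReal.ofReal (L a) ∂μ ≠ ∞ := hL.lintegral_lt_top.ne
  have h1 : ∫⁻ a, ENNReal.ofReal (f a) ∂μ + ∫⁻ a, ENNReal.ofReal (-L a) ∂μ =
      ∫⁻ a, ENNReal.ofReal (g a) ∂μ + ∫⁻ a, ENNReal.ofReal (L a) ∂μ := by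
    rw [← lintegral_add_left hf.ennreal_ofReal, ← lintegral_add_left hg.ennreal_ofReal]
    refine lintegral_congr fun a => ?_
    rcases le_total 0 (L a) with h0 | h0
    · rw [ENNReal.ofReal_of_nonpos (neg_nonpos.2 h0), add_zero, h a, ENNReal.ofReal_add (hg0 a) h0]
    · rw [ENNReal.ofReal_of_nonpos h0, add_zero,
        ← ENNReal.ofReal_add (hf0 a) (neg_nonneg.2 h0), h a]
      congr 1
      ring
  have h2 : ∫⁻ a, ENNReal.ofReal (L a) ∂μ =
      ENNReal.ofReal (∫ a, L a ∂μ) + ∫⁻ a, ENNReal.ofReal (-L a) ∂μ := by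
    have h3 := integral_eq_lintegral_pos_part_sub_lintegral_neg_part hL
    rw [← ENNReal.ofReal_toReal hn, ← ENNReal.ofReal_add hL0 ENNReal.toReal_nonneg, h3,
      sub_add_cancel, ENNReal.ofReal_toReal hp]
  rw [h2, ← add_assoc] at h1
  exact (ENNReal.add_left_inj hn).1 h1

/-- The divergence of a mixture decomposes through the mean. -/
lemma lintegral_klInt_eq_add {α : Type*} [MeasurableSpace α] (μ : Measure α)
    [IsProbabilityMeasure μ] {p : α → ℝ≥0∞} (hp : Measurable p) {q n : ℝ≥0∞}
    (hq : ∫⁻ a, p a ∂μ = q) (hqt : q ≠ ∞) (hn : n ≠ ∞) (hn0 : n = 0 → q = 0) :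
    ∫⁻ a, klInt (p a) n ∂μ = ∫⁻ a, klInt (p a) q ∂μ + klInt q n := by
  -- If the mean vanishes then so does `p` almost everywhere, and both sides reduce to `klInt 0 n`.
  rcases eq_or_ne q 0 with h0 | h0
  · rw [h0] at hq ⊢
    have hp0 : p =ᵐ[μ] 0 := (lintegral_eq_zero_iff hp).1 hq
    rw [lintegral_congr_ae (g := fun _ => klInt 0 n) (hp0.mono fun a ha => by simp [ha])]
    simp [klInt_zero_right]
  have hn1 : n ≠ 0 := fun h => h0 (hn0 h)
  have hN : 0 < n.toReal := ENNReal.toReal_pos hn1 hn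
  have hQ : 0 < q.toReal := ENNReal.toReal_pos h0 hqt
  have hfin : ∀ᵐ a ∂μ, p a < ∞ := ae_lt_top hp (by rw [hq]; exact hqt)
  have hint : Integrable (fun a => (p a).toReal) μ :=
    integrable_toReal_of_lintegral_ne_top hp.aemeasurable (by rw [hq]; exact hqt)
  have hval : ∫ a, (p a).toReal ∂μ = q.toReal := by
    rw [integral_toReal hp.aemeasurable hfin, hq]
  -- The expression is `c * klFun (x / c)`, hence nonnegative.
  have hnn : ∀ (x : ℝ) (c : ℝ), 0 ≤ x → 0 < c → 0 ≤ x * Real.log (x / c) + c - x := by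
    intro x c hx hc
    have := mul_nonneg hc.le (klFun_nonneg (x := x / c) (by positivity))
    rw [klFun] at this
    have e : c * (x / c * Real.log (x / c) + 1 - x / c) = x * Real.log (x / c) + c - x := by
      field_simp
    linarith
  have hm : ∀ c : ℝ, Measurable fun a =>
      (p a).toReal * Real.log ((p a).toReal / c) + c - (p a).toReal := by
    intro c
    have := hp.ennreal_toReal
    exact ((this.mul (Real.measurable_log.comp (this.div_const c))).add_const c).sub this
  -- The difference of the two integrands is affine in `p`, because the terms `p log p` cancel. Its
  -- integrability follows from that of `p`, and its integral is the real form of `klInt q n`.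
  have hLi : Integrable (fun a => (p a).toReal * Real.log (q.toReal / n.toReal)
      + (n.toReal - q.toReal)) μ := (hint.mul_const _).add (integrable_const _)
  have hLv : ∫ a, ((p a).toReal * Real.log (q.toReal / n.toReal) + (n.toReal - q.toReal)) ∂μ
      = q.toReal * Real.log (q.toReal / n.toReal) + n.toReal - q.toReal := by
    rw [integral_add (hint.mul_const _) (integrable_const _), integral_mul_const, hval]
    simp
    ring
  rw [lintegral_congr fun a => klInt_eq_ofReal hn hn1,
    lintegral_congr fun a => klInt_eq_ofReal hqt h0,
    klInt_eq_ofReal hn hn1, ← hLv]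
  refine lintegral_eq_add_of_sub_integrable (hm _) (hm _)
    (fun a => hnn _ _ ENNReal.toReal_nonneg hN) (fun a => hnn _ _ ENNReal.toReal_nonneg hQ)
    hLi (fun a => ?_) (by rw [hLv]; exact hnn _ _ hQ.le hN)
  rcases eq_or_ne (p a).toReal 0 with h | h
  · simp [h]
  · rw [Real.log_div h hN.ne', Real.log_div h hQ.ne', Real.log_div hQ.ne' hN.ne']
    ring

end Divergence

/-! ### Integration and measurability tools. -/

section Generic

variable {A B : Type*} [MeasurableSpace A] [MeasurableSpace B]

lemma measurable_of_sum_prod {Θ C : Type*} [MeasurableSpace Θ] [MeasurableSpace C]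
    {f : Θ × (A ⊕ B) → C} (hl : Measurable fun p : Θ × A => f (p.1, Sum.inl p.2))
    (hr : Measurable fun p : Θ × B => f (p.1, Sum.inr p.2)) : Measurable f := by
  have h : Measurable (f ∘ (MeasurableEquiv.prodSumDistrib Θ A B).symm) :=
    measurable_fun_sum hl hr
  have := h.comp (MeasurableEquiv.prodSumDistrib Θ A B).measurable
  convert this using 1
  ext x
  simp

lemma lintegral_pi_snoc (μ : Measure A) [SigmaFinite μ] (k : ℕ) {f : (Fin (k + 1) → A) → ℝ≥0∞}
    (hf : Measurable f) :
    ∫⁻ v, f v ∂(Measure.pi fun _ => μ) =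
      ∫⁻ u, ∫⁻ a, f (Fin.snoc u a) ∂μ ∂(Measure.pi fun _ : Fin k => μ) := by
  have h := (measurePreserving_piFinSuccAbove (fun _ : Fin (k + 1) => μ) (Fin.last k)).symm
  have h' := h.lintegral_comp hf
  rw [← h', lintegral_prod_symm]
  · refine lintegral_congr fun u => lintegral_congr fun a => ?_
    congr 1
    ext i
    simp [MeasurableEquiv.piFinSuccAbove, Fin.insertNthEquiv, Fin.insertNth_last']
  · exact (hf.comp h.measurable).aemeasurable

lemma lintegral_bool (μ : Measure Bool) (f : Bool → ℝ≥0∞) :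
    ∫⁻ n, f n ∂μ = f true * μ {true} + f false * μ {false} := by
  rw [lintegral_fintype]
  simp

/-- Normalizing and then weighting by the normalizer changes nothing, even when the normalizer is
zero: then `v` vanishes almost everywhere, and with it the numerator. Only the value `∞` has to be
excluded. -/
lemma lintegral_mul_lintegral_mul_div {μ : Measure A} {v w : A → ℝ≥0∞} (hv : Measurable v)
    (h : ∫⁻ a, v a ∂μ ≠ ∞) :
    (∫⁻ a, v a ∂μ) * ((∫⁻ a, v a * w a ∂μ) / ∫⁻ a, v a ∂μ) = ∫⁻ a, v a * w a ∂μ := by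
  rcases eq_or_ne (∫⁻ a, v a ∂μ) 0 with h0 | h0
  · have hv0 : v =ᵐ[μ] 0 := (lintegral_eq_zero_iff hv).1 h0
    rw [h0, zero_mul, lintegral_congr_ae (g := fun _ => 0) (hv0.mono fun a ha => by simp [ha])]
    simp
  · exact ENNReal.mul_div_cancel h0 h

lemma lintegral_mul_indicator_eq_zero {μ : Measure A} (n : A → ℝ≥0∞) :
    ∫⁻ a, n a * {a | n a = 0}.indicator 1 a ∂μ = 0 := by
  refine (lintegral_congr fun a => ?_).trans lintegral_zero
  by_cases h0 : n a = 0 <;> simp [h0]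

/-- Absolute continuity is obtained by integrating `f` over the zero set of `n`. Together with
`lintegral_mul_indicator_eq_zero`, it suffices to know that both densities give that set the same
mass. -/
lemma ae_eq_zero_of_lintegral_mul_indicator {μ : Measure A} {f n : A → ℝ≥0∞} (hf : Measurable f)
    (hn : Measurable n) (h : ∫⁻ a, f a * {a | n a = 0}.indicator 1 a ∂μ = 0) :
    ∀ᵐ a ∂μ, n a = 0 → f a = 0 := by
  have hm : Measurable fun a => f a * {a | n a = 0}.indicator 1 a :=
    hf.mul (measurable_one.indicator (measurableSet_eq_fun hn measurable_const))
  rw [lintegral_eq_zero_iff hm] at h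
  filter_upwards [h] with a ha h0
  simpa [h0] using ha

end Generic

variable {E F : Type*} [MeasurableSpace E] [MeasurableSpace F]

/-! ### Appending an entry, and measurable families of collections. -/

lemma measurable_fin_snoc {A Θ : Type*} [MeasurableSpace A] [MeasurableSpace Θ] {k : ℕ}
    {f : Θ → Fin k → A} {g : Θ → A} (hf : Measurable f) (hg : Measurable g) :
    Measurable fun t => (Fin.snoc (f t) (g t) : Fin (k + 1) → A) :=
  (measurable_snoc k).comp (hf.prodMk hg)

lemma measurable_fin_init {A : Type*} [MeasurableSpace A] {k : ℕ} :
    Measurable fun v : Fin (k + 1) → A => (Fin.init v : Fin k → A) :=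
  measurable_pi_lambda _ fun _ => measurable_pi_apply _

/-- The arguments of a belief state at time `k + 1`, from the memory and private sequence at
time `k`, the new entry of the memory, and the new state and private input. -/
def extend {k : ℕ} (m : Memory E k) (s : Sample E) (y : Fin (k + 1) → F) (w : E × F) :
    BeliefPoint E F (k + 1) :=
  (w.1, Fin.snoc m s, Fin.snoc y w.2)

lemma measurable_extend {Θ : Type*} [MeasurableSpace Θ] {k : ℕ} {m : Θ → Memory E k}
    {s : Θ → Sample E} {y : Θ → Fin (k + 1) → F} {w : Θ → E × F} (hm : Measurable m)
    (hs : Measurable s) (hy : Measurable y) (hw : Measurable w) :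
    Measurable fun t => extend (m t) (s t) (y t) (w t) :=
  hw.fst.prodMk ((measurable_fin_snoc hm hs).prodMk (measurable_fin_snoc hy hw.snd))

lemma Collection.measurable_prob {k : ℕ} (a : Collection E k) (n : Bool) :
    Measurable fun p : E × Memory E k => a.prob n p.1 p.2 :=
  Kernel.measurable_coe a.kernel (measurableSet_singleton n)

lemma Collection.prob_add_prob {k : ℕ} (a : Collection E k) (x : E) (m : Memory E k) :
    a.prob true x m + a.prob false x m = 1 := by
  have := a.markov
  have h := lintegral_bool (a.kernel (x, m)) fun _ => 1
  rw [lintegral_one, measure_univ, one_mul, one_mul] at h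
  exact h.symm

lemma measurable_apply_apply {A B C Θ : Type*} [MeasurableSpace A] [MeasurableSpace B]
    [MeasurableSpace C] [MeasurableSpace Θ] {f : A → B → C} (hf : Measurable (Function.uncurry f))
    {u : Θ → A} {v : Θ → B} (hu : Measurable u) (hv : Measurable v) :
    Measurable fun t => f (u t) (v t) :=
  hf.comp (hu.prodMk hv)

/-- A family of policy collections with jointly measurable probabilities. -/
def MeasurableCollection {Θ : Type*} [MeasurableSpace Θ] {k : ℕ} (a : Θ → Collection E k) :
    Prop :=
  ∀ n, Measurable fun p : Θ × E × Memory E k => (a p.1).prob n p.2.1 p.2.2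

lemma MeasurableCollection.comp {Θ Ξ : Type*} [MeasurableSpace Θ] [MeasurableSpace Ξ] {k : ℕ}
    {a : Θ → Collection E k} (ha : MeasurableCollection a) (n : Bool) {u : Ξ → Θ} {x : Ξ → E}
    {m : Ξ → Memory E k} (hu : Measurable u) (hx : Measurable x) (hm : Measurable m) :
    Measurable fun t => (a (u t)).prob n (x t) (m t) :=
  Measurable.comp (ha n) (hu.prodMk (hx.prodMk hm))

lemma measurableCollection_const {Θ : Type*} [MeasurableSpace Θ] {k : ℕ} (a : Collection E k) :
    MeasurableCollection fun _ : Θ => a :=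
  fun n => (a.measurable_prob n).comp measurable_snd

/-! ### Reference measures and transition densities. -/

namespace Model

variable (P : Model E F)

instance : SigmaFinite P.refSample := by
  unfold refSample
  have : SigmaFinite (P.refX.map (Sum.inl : E → Sample E)) :=
    MeasurableEmbedding.sigmaFinite_map
      ⟨Sum.inl_injective, measurable_inl, fun _ => MeasurableSet.inl_image⟩
  infer_instance

instance (k : ℕ) : SigmaFinite (P.refMemory k) := by
  unfold refMemory
  infer_instance

instance (k : ℕ) : SigmaFinite (P.refPriv k) := by
  unfold refPriv
  infer_instance

instance (k : ℕ) : SigmaFinite (P.refBelief k) := by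
  unfold refBelief
  infer_instance

lemma lintegral_refSample {f : Sample E → ℝ≥0∞} (hf : Measurable f) :
    ∫⁻ z, f z ∂P.refSample = ∫⁻ x, f (Sum.inl x) ∂P.refX + f (Sum.inr ()) := by
  rw [refSample, lintegral_add_measure, lintegral_map hf measurable_inl, lintegral_dirac' _ hf]

/-- A rearrangement by Tonelli into the order suited to the update: old memory and old private
sequence, then the new memory entry, on which `update` splits into cases, and innermost the new
state and private input. -/
lemma lintegral_refBelief_succ {k : ℕ} {G : BeliefPoint E F (k + 1) → ℝ≥0∞} (hG : Measurable G) :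
    ∫⁻ q, G q ∂(P.refBelief (k + 1)) =
      ∫⁻ r, ∫⁻ s, ∫⁻ w, G (extend r.1 s r.2 w) ∂(P.refX.prod P.refY) ∂P.refSample
        ∂((P.refMemory k).prod (P.refPriv k)) := by
  have e1 : ∀ x : E, ∀ M : Memory E (k + 1),
      ∫⁻ Y, G (x, M, Y) ∂(P.refPriv (k + 1)) =
        ∫⁻ y, ∫⁻ y', G (x, M, Fin.snoc y y') ∂P.refY ∂(P.refPriv k) := fun x M =>
    lintegral_pi_snoc P.refY (k + 1) (hG.comp (by fun_prop))
  have hG2 : Measurable fun t : E × Memory E (k + 1) =>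
      ∫⁻ Y, G (t.1, t.2, Y) ∂(P.refPriv (k + 1)) :=
    Measurable.lintegral_prod_right' (f := fun t : (E × Memory E (k + 1)) × (Fin (k + 2) → F) =>
      G (t.1.1, t.1.2, t.2)) (hG.comp (by fun_prop))
  have e2 : ∀ x : E, ∫⁻ M, ∫⁻ Y, G (x, M, Y) ∂(P.refPriv (k + 1)) ∂(P.refMemory (k + 1)) =
        ∫⁻ m, ∫⁻ s, ∫⁻ y, ∫⁻ y', G (extend m s y (x, y')) ∂P.refY ∂(P.refPriv k)
          ∂P.refSample ∂(P.refMemory k) := fun x => by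
    refine (lintegral_pi_snoc P.refSample k (hG2.comp (measurable_prodMk_left (x := x)))).trans ?_
    simp only [Function.comp_apply, e1]
    rfl
  have hr : Measurable fun t : ((E × Memory E k) × Sample E) × (Fin (k + 1) → F) =>
      ∫⁻ y', G (extend t.1.1.2 t.1.2 t.2 (t.1.1.1, y')) ∂P.refY :=
    Measurable.lintegral_prod_right'
      (f := fun t : (((E × Memory E k) × Sample E) × (Fin (k + 1) → F)) × F =>
        G (extend t.1.1.1.2 t.1.1.2 t.1.2 (t.1.1.1.1, t.2))) (hG.comp (measurable_extend
          (by fun_prop) (by fun_prop) (by fun_prop) (by fun_prop)))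
  have hr2 : Measurable fun t : (E × Memory E k) × Sample E =>
      ∫⁻ y, ∫⁻ y', G (extend t.1.2 t.2 y (t.1.1, y')) ∂P.refY ∂(P.refPriv k) :=
    hr.lintegral_prod_right'
  have hr3 : Measurable fun t : E × Memory E k =>
      ∫⁻ s, ∫⁻ y, ∫⁻ y', G (extend t.2 s y (t.1, y')) ∂P.refY ∂(P.refPriv k) ∂P.refSample :=
    hr2.lintegral_prod_right'
  rw [refBelief, lintegral_prod _ hG.aemeasurable]
  have e3 : ∀ x : E, ∫⁻ u, G (x, u) ∂((P.refMemory (k + 1)).prod (P.refPriv (k + 1))) =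
      ∫⁻ M, ∫⁻ Y, G (x, M, Y) ∂(P.refPriv (k + 1)) ∂(P.refMemory (k + 1)) := fun x =>
    lintegral_prod _ (hG.comp measurable_prodMk_left).aemeasurable
  simp_rw [e3, e2]
  rw [lintegral_lintegral_swap hr3.aemeasurable]
  have hl : Measurable fun t : ((Memory E k × (Fin (k + 1) → F)) × Sample E) × (E × F) =>
      G (extend t.1.1.1 t.1.2 t.1.1.2 t.2) := 
    hG.comp (measurable_extend (by fun_prop) (by fun_prop) (by fun_prop) (by fun_prop))
  rw [lintegral_prod _ (Measurable.lintegral_prod_right'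
    (f := fun t : (Memory E k × (Fin (k + 1) → F)) × Sample E =>
      ∫⁻ w, G (extend t.1.1 t.2 t.1.2 w) ∂(P.refX.prod P.refY))
      hl.lintegral_prod_right').aemeasurable]
  refine lintegral_congr fun m => ?_
  have e4 : ∀ (y : Fin (k + 1) → F) (s : Sample E),
      ∫⁻ w, G (extend m s y w) ∂(P.refX.prod P.refY) =
        ∫⁻ x, ∫⁻ y', G (extend m s y (x, y')) ∂P.refY ∂P.refX := fun y s =>
    lintegral_prod _ (hl.comp (f := fun w : E × F => (((m, y), s), w)) (by fun_prop)).aemeasurable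
  simp_rw [e4]
  rw [lintegral_lintegral_swap (f := fun (x : E) (s : Sample E) =>
    ∫⁻ y, ∫⁻ y', G (extend m s y (x, y')) ∂P.refY ∂(P.refPriv k))
    (hr2.comp (f := fun t : E × Sample E => ((t.1, m), t.2)) (by fun_prop)).aemeasurable]
  rw [lintegral_lintegral_swap (f := fun (y : Fin (k + 1) → F) (s : Sample E) =>
    ∫⁻ x, ∫⁻ y', G (extend m s y (x, y')) ∂P.refY ∂P.refX)
    (Measurable.lintegral_prod_right' (f := fun t : ((Fin (k + 1) → F) × Sample E) × E =>
      ∫⁻ y', G (extend m t.1.2 t.1.1 (t.2, y')) ∂P.refY)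
      (hr.comp (f := fun t : ((Fin (k + 1) → F) × Sample E) × E =>
        (((t.2, m), t.1.2), t.1.1)) (by fun_prop))).aemeasurable]
  refine lintegral_congr fun s => ?_
  rw [lintegral_lintegral_swap (f := fun (x : E) (y : Fin (k + 1) → F) =>
    ∫⁻ y', G (extend m s y (x, y')) ∂P.refY) (hr.comp
      (f := fun t : E × (Fin (k + 1) → F) => (((t.1, m), s), t.2)) (by fun_prop)).aemeasurable]

/-- The density of `(X_{k+1}, Y_{k+1})` given `X_k = x` and `Y_k = y`. -/
def trans (x : E) (y : F) (w : E × F) : ℝ≥0∞ :=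
  P.stateDensity (x, y) w.1 * P.privDensity y w.2

lemma measurable_trans {Θ : Type*} [MeasurableSpace Θ] {x : Θ → E} {y : Θ → F} {w : Θ → E × F}
    (hx : Measurable x) (hy : Measurable y) (hw : Measurable w) :
    Measurable fun t => P.trans (x t) (y t) (w t) :=
  (P.measurable_stateDensity.comp ((hx.prodMk hy).prodMk hw.fst)).mul
    (P.measurable_privDensity.comp (hy.prodMk hw.snd))

/-- The state density integrates to one, so `Y` evolves as a Markov chain on its own. -/
lemma lintegral_trans_mul (x : E) (y : F) {f : F → ℝ≥0∞} (hf : Measurable f) :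
    ∫⁻ w, P.trans x y w * f w.2 ∂(P.refX.prod P.refY) =
      ∫⁻ y', P.privDensity y y' * f y' ∂P.refY := by
  have hs : Measurable (P.stateDensity (x, y)) := P.measurable_stateDensity.of_uncurry_left
  have hp : Measurable (P.privDensity y) := P.measurable_privDensity.of_uncurry_left
  simp_rw [trans, mul_assoc]
  have := lintegral_prod_mul (μ := P.refX) (ν := P.refY) hs.aemeasurable (hp.mul hf).aemeasurable
  rw [P.lintegral_stateDensity, one_mul] at this
  exact this

lemma lintegral_trans (x : E) (y : F) :
    ∫⁻ w, P.trans x y w ∂(P.refX.prod P.refY) = 1 := by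
  have := P.lintegral_trans_mul x y (f := fun _ => 1) measurable_const
  simpa [P.lintegral_privDensity] using this

/-- The expectation of `H` over the next state and private input. -/
def next {k : ℕ} (H : BeliefPoint E F (k + 1) → ℝ≥0∞) (x : E) (m : Memory E k) (s : Sample E)
    (y : Fin (k + 1) → F) : ℝ≥0∞ :=
  ∫⁻ w, P.trans x (y (Fin.last k)) w * H (extend m s y w) ∂(P.refX.prod P.refY)

lemma measurable_next {Θ : Type*} [MeasurableSpace Θ] {k : ℕ}
    {H : Θ → BeliefPoint E F (k + 1) → ℝ≥0∞} (hH : Measurable (Function.uncurry H))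
    {x : Θ → E} {m : Θ → Memory E k} {s : Θ → Sample E} {y : Θ → Fin (k + 1) → F}
    (hx : Measurable x) (hm : Measurable m) (hs : Measurable s) (hy : Measurable y) :
    Measurable fun t => P.next (H t) (x t) (m t) (s t) (y t) := by
  refine Measurable.lintegral_prod_right' (f := fun t : Θ × (E × F) =>
    P.trans (x t.1) (y t.1 (Fin.last k)) t.2 * H t.1 (extend (m t.1) (s t.1) (y t.1) t.2)) ?_
  refine (P.measurable_trans (by fun_prop) (by fun_prop) (by fun_prop)).mul
    (hH.comp (measurable_fst.prodMk (measurable_extend (by fun_prop) (by fun_prop) (by fun_prop)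
      (by fun_prop))))

lemma next_const {k : ℕ} (c : ℝ≥0∞) (x : E) (m : Memory E k) (s : Sample E)
    (y : Fin (k + 1) → F) : P.next (fun _ => c) x m s y = c := by
  have : Measurable (P.trans x (y (Fin.last k))) :=
    P.measurable_trans measurable_const measurable_const measurable_id
  rw [next, lintegral_mul_const _ this, lintegral_trans, one_mul]

/-! ## One step of the belief recursion -/

section OneStep

variable {k : ℕ}

lemma update_blank_inl (b : Belief E F k) (a : Collection E k) (m : Memory E k) (x : E)
    (y : Fin (k + 1) → F) (w : E × F) (u : Unit) :
    P.update b a (Sum.inr u) (extend m (Sum.inl x) y w) =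
      P.trans x (y (Fin.last k)) w * b (x, m, y) * a.prob false x m
        / P.outDensity b a (Sum.inr u) := by
  simp [update, extend, trans]

lemma update_blank_inr (b : Belief E F k) (a : Collection E k) (m : Memory E k)
    (y : Fin (k + 1) → F) (w : E × F) (u : Unit) :
    P.update b a (Sum.inr u) (extend m (Sum.inr ()) y w) = 0 := by
  simp [update, extend]

lemma update_inl_inr (b : Belief E F k) (a : Collection E k) (m : Memory E k) (x : E)
    (y : Fin (k + 1) → F) (w : E × F) :
    P.update b a (Sum.inl x) (extend m (Sum.inr ()) y w) =
      P.trans x (y (Fin.last k)) w * b (x, m, y) * a.prob true x m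
        / P.outDensity b a (Sum.inl x) := by
  simp [update, extend, trans]

lemma update_inl_inl (b : Belief E F k) (a : Collection E k) (m : Memory E k) (x x' : E)
    (y : Fin (k + 1) → F) (w : E × F) :
    P.update b a (Sum.inl x) (extend m (Sum.inl x') y w) = 0 := by
  simp [update, extend]

/-- The unnormalized density of `Y^k` given `Z_k`. -/
def outNum (b : Belief E F k) (a : Collection E k) : Sample E → (Fin (k + 1) → F) → ℝ≥0∞
  | Sum.inr _, y => ∫⁻ r : E × Memory E k, a.prob false r.1 r.2 * b (r.1, r.2, y)
      ∂(P.refX.prod (P.refMemory k))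
  | Sum.inl x, y => ∫⁻ m, a.prob true x m * b (x, m, y) ∂(P.refMemory k)

/-- The density of `Y^k` given `Z_k`. -/
def postDensity (b : Belief E F k) (a : Collection E k) (z : Sample E) (y : Fin (k + 1) → F) :
    ℝ≥0∞ :=
  P.outNum b a z y / P.outDensity b a z

/-- The `y`-marginal of a belief state. -/
def priorDensity (b : Belief E F k) (y : Fin (k + 1) → F) : ℝ≥0∞ :=
  ∫⁻ r : E × Memory E k, b (r.1, r.2, y) ∂(P.refX.prod (P.refMemory k))

lemma posteriorPriv_eq (b : Belief E F k) (a : Collection E k) (z : Sample E) :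
    P.posteriorPriv b a z = (P.refPriv k).withDensity (P.postDensity b a z) := by
  cases z <;> rfl

section Measurability

variable {Θ : Type*} [MeasurableSpace Θ] {b : Θ → Belief E F k} {a : Θ → Collection E k}

lemma measurable_outNum (hb : Measurable (Function.uncurry b))
    (ha : MeasurableCollection a) :
    Measurable fun p : (Θ × (Fin (k + 1) → F)) × Sample E =>
      P.outNum (b p.1.1) (a p.1.1) p.2 p.1.2 := by
  refine measurable_of_sum_prod ?_ ?_
  · refine Measurable.lintegral_prod_right'
      (f := fun t : ((Θ × (Fin (k + 1) → F)) × E) × Memory E k =>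
        (a t.1.1.1).prob true t.1.2 t.2 * b t.1.1.1 (t.1.2, t.2, t.1.1.2)) ?_
    exact (ha.comp true (by fun_prop) (by fun_prop) (by fun_prop)).mul
      (measurable_apply_apply hb (by fun_prop) (by fun_prop))
  · refine Measurable.lintegral_prod_right'
      (f := fun t : ((Θ × (Fin (k + 1) → F)) × Unit) × E × Memory E k =>
        (a t.1.1.1).prob false t.2.1 t.2.2 * b t.1.1.1 (t.2.1, t.2.2, t.1.1.2)) ?_
    exact (ha.comp false (by fun_prop) (by fun_prop) (by fun_prop)).mul
      (measurable_apply_apply hb (by fun_prop) (by fun_prop))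

lemma measurable_outDensity (hb : Measurable (Function.uncurry b))
    (ha : MeasurableCollection a) :
    Measurable fun p : Θ × Sample E => P.outDensity (b p.1) (a p.1) p.2 := by
  refine measurable_of_sum_prod ?_ ?_
  · refine Measurable.lintegral_prod_right'
      (f := fun t : (Θ × E) × Memory E k × (Fin (k + 1) → F) =>
        (a t.1.1).prob true t.1.2 t.2.1 * b t.1.1 (t.1.2, t.2)) ?_
    exact (ha.comp true (by fun_prop) (by fun_prop) (by fun_prop)).mul
      (measurable_apply_apply hb (by fun_prop) (by fun_prop))
  · refine Measurable.lintegral_prod_right'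
      (f := fun t : (Θ × Unit) × BeliefPoint E F k =>
        (a t.1.1).prob false t.2.1 t.2.2.1 * b t.1.1 t.2) ?_
    exact (ha.comp false (by fun_prop) (by fun_prop) (by fun_prop)).mul
      (measurable_apply_apply hb (by fun_prop) (by fun_prop))

lemma measurable_postDensity (hb : Measurable (Function.uncurry b))
    (ha : MeasurableCollection a) :
    Measurable fun p : (Θ × (Fin (k + 1) → F)) × Sample E =>
      P.postDensity (b p.1.1) (a p.1.1) p.2 p.1.2 :=
  (P.measurable_outNum hb ha).div
    ((P.measurable_outDensity hb ha).comp (measurable_fst.fst.prodMk measurable_snd))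

lemma measurable_priorDensity (hb : Measurable (Function.uncurry b)) :
    Measurable fun p : Θ × (Fin (k + 1) → F) => P.priorDensity (b p.1) p.2 := by
  refine Measurable.lintegral_prod_right'
    (f := fun t : (Θ × (Fin (k + 1) → F)) × E × Memory E k =>
      b t.1.1 (t.2.1, t.2.2, t.1.2)) ?_
  exact measurable_apply_apply hb (by fun_prop) (by fun_prop)

/-- `update` is defined by cases on the sample and on the last memory entry. With the point written
as `extend`, both become free variables of sum type and each of the four branches is explicit;
splitting off the last coordinates returns to a general point. -/
lemma measurable_update (hb : Measurable (Function.uncurry b))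
    (ha : MeasurableCollection a) :
    Measurable fun p : (Θ × Sample E) × BeliefPoint E F (k + 1) =>
      P.update (b p.1.1) (a p.1.1) p.1.2 p.2 := by
  have key : Measurable fun t : ((Θ × Memory E k × (Fin (k + 1) → F) × E × F) × Sample E) × Sample E
      => P.update (b t.1.1.1) (a t.1.1.1) t.1.2 (extend t.1.1.2.1 t.2 t.1.1.2.2.1 t.1.1.2.2.2) := by
    have hd := P.measurable_outDensity hb ha
    refine measurable_of_sum_prod ?_ ?_
    · refine (measurable_of_sum_prod (f := fun p : ((Θ × Memory E k × (Fin (k + 1) → F) × E × F)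
        × E) × Sample E => P.update (b p.1.1.1) (a p.1.1.1) p.2
          (extend p.1.1.2.1 (Sum.inl p.1.2) p.1.1.2.2.1 p.1.1.2.2.2)) ?_ ?_).comp
          ((measurable_fst.fst.prodMk measurable_snd).prodMk measurable_fst.snd)
      · simp only [update_inl_inl]
        exact measurable_const
      · simp only [update_blank_inl]
        refine Measurable.div (Measurable.mul (Measurable.mul ?_ ?_) ?_) ?_
        · exact P.measurable_trans (by fun_prop) (by fun_prop) (by fun_prop)
        · exact measurable_apply_apply hb (by fun_prop) (by fun_prop)
        · exact ha.comp false (by fun_prop) (by fun_prop) (by fun_prop)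
        · exact hd.comp (f := fun t : ((Θ × Memory E k × (Fin (k + 1) → F) × E × F) × E)
            × Unit => (t.1.1.1, Sum.inr t.2))
            (measurable_fst.fst.fst.prodMk (measurable_inr.comp measurable_snd))
    · refine (measurable_of_sum_prod (f := fun p : (Θ × Memory E k × (Fin (k + 1) → F) × E × F)
        × Sample E => P.update (b p.1.1) (a p.1.1) p.2
          (extend p.1.2.1 (Sum.inr ()) p.1.2.2.1 p.1.2.2.2)) ?_ ?_).comp measurable_fst
      · simp only [update_inl_inr]
        refine Measurable.div (Measurable.mul (Measurable.mul ?_ ?_) ?_) ?_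
        · exact P.measurable_trans (by fun_prop) (by fun_prop) (by fun_prop)
        · exact measurable_apply_apply hb (by fun_prop) (by fun_prop)
        · exact ha.comp true (by fun_prop) (by fun_prop) (by fun_prop)
        · exact hd.comp (f := fun t : (Θ × Memory E k × (Fin (k + 1) → F) × E × F) × E =>
            (t.1.1, Sum.inl t.2)) (measurable_fst.fst.prodMk (measurable_inl.comp measurable_snd))
      · simp only [update_blank_inr]
        exact measurable_const
  have hpre : Measurable fun p : (Θ × Sample E) × BeliefPoint E F (k + 1) =>
      (((p.1.1, (Fin.init p.2.2.1 : Memory E k), (Fin.init p.2.2.2 : Fin (k + 1) → F), p.2.1,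
        p.2.2.2 (Fin.last (k + 1))), p.1.2), p.2.2.1 (Fin.last k)) := by
    have h1 : Measurable fun p : (Θ × Sample E) × BeliefPoint E F (k + 1) =>
        (Fin.init p.2.2.1 : Memory E k) := measurable_fin_init.comp (by fun_prop)
    have h2 : Measurable fun p : (Θ × Sample E) × BeliefPoint E F (k + 1) =>
        (Fin.init p.2.2.2 : Fin (k + 1) → F) := measurable_fin_init.comp (by fun_prop)
    fun_prop
  have := key.comp hpre
  convert this using 1
  ext p
  simp [extend]

end Measurability

end OneStep

end Model

/-! ### Integration against the updated belief and the law of the sample. -/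

namespace Model

variable (P : Model E F) {k : ℕ}

lemma measurable_belief_const {Θ : Type*} [MeasurableSpace Θ] {b : Belief E F k}
    (hb : Measurable b) : Measurable (Function.uncurry fun _ : Θ => b) :=
  hb.comp measurable_snd

lemma measurable_outNum_apply {b : Belief E F k} (hb : Measurable b) (a : Collection E k) :
    Measurable fun p : (Fin (k + 1) → F) × Sample E => P.outNum b a p.2 p.1 :=
  (P.measurable_outNum (measurable_belief_const (Θ := Unit) hb)
    (measurableCollection_const a)).comp
    ((measurable_const (a := ()).prodMk measurable_fst).prodMk measurable_snd)

lemma measurable_outDensity_apply {b : Belief E F k} (hb : Measurable b) (a : Collection E k) :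
    Measurable (P.outDensity b a) :=
  (P.measurable_outDensity (measurable_belief_const (Θ := Unit) hb)
    (measurableCollection_const a)).comp (measurable_prodMk_left (x := ()))

lemma measurable_postDensity_apply {b : Belief E F k} (hb : Measurable b) (a : Collection E k) :
    Measurable fun p : (Fin (k + 1) → F) × Sample E => P.postDensity b a p.2 p.1 :=
  (P.measurable_outNum_apply hb a).div ((P.measurable_outDensity_apply hb a).comp measurable_snd)

lemma measurable_priorDensity_apply {b : Belief E F k} (hb : Measurable b) :
    Measurable (P.priorDensity b) :=
  (P.measurable_priorDensity (measurable_belief_const (Θ := Unit) hb)).comp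
    (measurable_prodMk_left (x := ()))

lemma measurable_outNum_left {b : Belief E F k} (hb : Measurable b) (a : Collection E k)
    (y : Fin (k + 1) → F) : Measurable fun z => P.outNum b a z y :=
  (P.measurable_outNum_apply hb a).comp measurable_prodMk_left

lemma measurable_outNum_right {b : Belief E F k} (hb : Measurable b) (a : Collection E k)
    (z : Sample E) : Measurable (P.outNum b a z) :=
  (P.measurable_outNum_apply hb a).comp measurable_prodMk_right

lemma measurable_postDensity_left {b : Belief E F k} (hb : Measurable b) (a : Collection E k)
    (y : Fin (k + 1) → F) : Measurable fun z => P.postDensity b a z y :=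
  (P.measurable_postDensity_apply hb a).comp measurable_prodMk_left

lemma measurable_postDensity_right {b : Belief E F k} (hb : Measurable b) (a : Collection E k)
    (z : Sample E) : Measurable (P.postDensity b a z) :=
  (P.measurable_postDensity_apply hb a).comp measurable_prodMk_right

lemma measurable_prob_mul {b : Belief E F k} (hb : Measurable b) (a : Collection E k) (n : Bool) :
    Measurable fun q : BeliefPoint E F k => a.prob n q.1 q.2.1 * b q :=
  ((a.measurable_prob n).comp (f := fun q : BeliefPoint E F k => (q.1, q.2.1))
    (by fun_prop)).mul hb

lemma measurable_prob_mul_right {b : Belief E F k} (hb : Measurable b) (a : Collection E k)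
    (n : Bool) (x : E) :
    Measurable fun r : Memory E k × (Fin (k + 1) → F) => a.prob n x r.1 * b (x, r) :=
  (measurable_prob_mul hb a n).comp measurable_prodMk_left

lemma measurable_update_apply {b : Belief E F k} (hb : Measurable b) (a : Collection E k) :
    Measurable fun p : Sample E × BeliefPoint E F (k + 1) => P.update b a p.1 p.2 :=
  (P.measurable_update (measurable_belief_const (Θ := Unit) hb)
    (measurableCollection_const a)).comp
    ((measurable_const (a := ()).prodMk measurable_fst).prodMk measurable_snd)

lemma measurable_next_apply {H : BeliefPoint E F (k + 1) → ℝ≥0∞} (hH : Measurable H)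
    {Θ : Type*} [MeasurableSpace Θ] {x : Θ → E} {m : Θ → Memory E k} {s : Θ → Sample E}
    {y : Θ → Fin (k + 1) → F} (hx : Measurable x) (hm : Measurable m) (hs : Measurable s)
    (hy : Measurable y) : Measurable fun t => P.next H (x t) (m t) (s t) (y t) :=
  P.measurable_next (H := fun _ => H) (hH.comp measurable_snd) hx hm hs hy

/-- After a retained sample only a blank memory entry carries mass. The old state is fixed by the
sample, so only memory and private sequence remain to be integrated. -/
lemma lintegral_update_inl {b : Belief E F k} (hb : Measurable b) (a : Collection E k) (x : E)
    {H : BeliefPoint E F (k + 1) → ℝ≥0∞} (hH : Measurable H) :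
    ∫⁻ q, P.update b a (Sum.inl x) q * H q ∂(P.refBelief (k + 1)) =
      (∫⁻ r, (a.prob true x r.1 * b (x, r)) * P.next H x r.1 (Sum.inr ()) r.2
        ∂((P.refMemory k).prod (P.refPriv k))) / P.outDensity b a (Sum.inl x) := by
  have hU : Measurable fun q => P.update b a (Sum.inl x) q * H q :=
    ((P.measurable_update_apply hb a).comp measurable_prodMk_left).mul hH
  rw [P.lintegral_refBelief_succ hU, div_eq_mul_inv, ← lintegral_mul_const]
  · refine lintegral_congr fun r => ?_
    rw [P.lintegral_refSample (Measurable.lintegral_prod_right' (f := fun t : Sample E × E × F =>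
      P.update b a (Sum.inl x) (extend r.1 t.1 r.2 t.2) * H (extend r.1 t.1 r.2 t.2))
      (hU.comp (measurable_extend (by fun_prop) (by fun_prop) (by fun_prop) (by fun_prop))))]
    simp only [update_inl_inl, update_inl_inr, zero_mul, lintegral_zero, zero_add]
    rw [next, ← lintegral_const_mul, ← lintegral_mul_const]
    · refine lintegral_congr fun w => ?_
      rw [div_eq_mul_inv]
      ring
    all_goals
      have := P.measurable_trans (x := fun _ : E × F => x)
        (y := fun _ => r.2 (Fin.last k)) (w := id) (by fun_prop) (by fun_prop) (by fun_prop)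
      have := this.mul (hH.comp (measurable_extend (m := fun _ : E × F => r.1)
        (s := fun _ => Sum.inr ()) (y := fun _ => r.2) (w := id) (by fun_prop) (by fun_prop)
        (by fun_prop) (by fun_prop)))
      first | exact this | exact this.const_mul _
  · exact (measurable_prob_mul_right hb a true x).mul
      (P.measurable_next_apply hH (by fun_prop) (by fun_prop) (by fun_prop) (by fun_prop))

/-- After a discard the old state survives as the last memory entry. Integrating over that entry
supplies the integral over `x_k`, and the full reference measure at time `k` reappears. -/
lemma lintegral_update_blank {b : Belief E F k} (hb : Measurable b) (a : Collection E k)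
    {H : BeliefPoint E F (k + 1) → ℝ≥0∞} (hH : Measurable H) :
    ∫⁻ q, P.update b a (Sum.inr ()) q * H q ∂(P.refBelief (k + 1)) =
      (∫⁻ q, (a.prob false q.1 q.2.1 * b q) * P.next H q.1 q.2.1 (Sum.inl q.1) q.2.2
        ∂(P.refBelief k)) / P.outDensity b a (Sum.inr ()) := by
  have hU : Measurable fun q => P.update b a (Sum.inr ()) q * H q :=
    ((P.measurable_update_apply hb a).comp measurable_prodMk_left).mul hH
  have hm : Measurable fun q : BeliefPoint E F k =>
      (a.prob false q.1 q.2.1 * b q) * P.next H q.1 q.2.1 (Sum.inl q.1) q.2.2 :=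
    (measurable_prob_mul hb a false).mul
      (P.measurable_next_apply hH (by fun_prop) (by fun_prop)
        (measurable_inl.comp measurable_fst) (by fun_prop))
  rw [P.lintegral_refBelief_succ hU, div_eq_mul_inv, ← lintegral_mul_const _ hm, refBelief,
    lintegral_prod_symm _ (hm.mul_const _).aemeasurable]
  refine lintegral_congr fun r => ?_
  rw [P.lintegral_refSample (Measurable.lintegral_prod_right' (f := fun t : Sample E × E × F =>
      P.update b a (Sum.inr ()) (extend r.1 t.1 r.2 t.2) * H (extend r.1 t.1 r.2 t.2))
      (hU.comp (measurable_extend (by fun_prop) (by fun_prop) (by fun_prop) (by fun_prop))))]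
  simp only [update_blank_inl, update_blank_inr, zero_mul, lintegral_zero, add_zero]
  refine lintegral_congr fun x => ?_
  rw [next, ← lintegral_const_mul, ← lintegral_mul_const]
  · refine lintegral_congr fun w => ?_
    rw [div_eq_mul_inv]
    ring
  all_goals
    have := P.measurable_trans (x := fun _ : E × F => x)
      (y := fun _ => r.2 (Fin.last k)) (w := id) (by fun_prop) (by fun_prop) (by fun_prop)
    have := this.mul (hH.comp (measurable_extend (m := fun _ : E × F => r.1)
      (s := fun _ => Sum.inl x) (y := fun _ => r.2) (w := id) (by fun_prop) (by fun_prop)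
      (by fun_prop) (by fun_prop)))
    first | exact this | exact this.const_mul _

lemma lintegral_outLaw {b : Belief E F k} (hb : Measurable b) (a : Collection E k)
    {h : Sample E → ℝ≥0∞} (hh : Measurable h) :
    ∫⁻ z, h z ∂(P.outLaw b a) = ∫⁻ x, P.outDensity b a (Sum.inl x) * h (Sum.inl x) ∂P.refX
      + P.outDensity b a (Sum.inr ()) * h (Sum.inr ()) := by
  have hd := P.measurable_outDensity_apply hb a
  rw [outLaw, lintegral_withDensity_eq_lintegral_mul _ hd hh]
  exact P.lintegral_refSample (hd.mul hh)

/-- The sum over the decisions, weighted with a belief state. -/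
lemma lintegral_belief_decision {b : Belief E F k} (hb : Measurable b) (a : Collection E k)
    {G : BeliefPoint E F k → Bool → ℝ≥0∞} (hG : ∀ n, Measurable fun q => G q n) :
    ∫⁻ q, b q * ∫⁻ n, G q n ∂(a.kernel (q.1, q.2.1)) ∂(P.refBelief k) =
      (∫⁻ x, ∫⁻ r, (a.prob true x r.1 * b (x, r)) * G (x, r) true
        ∂((P.refMemory k).prod (P.refPriv k)) ∂P.refX) +
      ∫⁻ q, (a.prob false q.1 q.2.1 * b q) * G q false ∂(P.refBelief k) := by
  have h1 : ∀ n, Measurable fun q : BeliefPoint E F k =>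
      (a.prob n q.1 q.2.1 * b q) * G q n := fun n =>
    (measurable_prob_mul hb a n).mul (hG n)
  have := lintegral_prod (μ := P.refX) (ν := (P.refMemory k).prod (P.refPriv k)) _
    (h1 true).aemeasurable
  rw [← this]
  refine Eq.trans ?_ (lintegral_add_left (h1 true) _)
  refine lintegral_congr fun q => ?_
  rw [lintegral_bool]
  simp only [Collection.prob]
  ring

lemma lintegral_outLaw_eq {b : Belief E F k} (hb : Measurable b) (a : Collection E k)
    {h : Sample E → ℝ≥0∞} (hh : Measurable h) :
    ∫⁻ z, h z ∂(P.outLaw b a) =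
      ∫⁻ q, b q * ∫⁻ n, h (sampleOut q.1 n) ∂(a.kernel (q.1, q.2.1)) ∂(P.refBelief k) := by
  have hs : ∀ n, Measurable fun q : BeliefPoint E F k => h (sampleOut q.1 n) := fun n =>
    hh.comp (measurable_sampleOut.comp (f := fun q : BeliefPoint E F k => (q.1, n)) (by fun_prop))
  rw [P.lintegral_belief_decision hb a hs, P.lintegral_outLaw hb a hh]
  congr 1
  · refine lintegral_congr fun x => ?_
    exact (lintegral_mul_const _ (measurable_prob_mul_right hb a true x)).symm
  · exact (lintegral_mul_const _ (measurable_prob_mul hb a false)).symm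

lemma isProbabilityMeasure_outLaw {b : Belief E F k} (hb : Measurable b) (a : Collection E k)
    (h1 : ∫⁻ q, b q ∂(P.refBelief k) = 1) : IsProbabilityMeasure (P.outLaw b a) := by
  constructor
  have := a.markov
  have := P.lintegral_outLaw_eq hb a (h := fun _ => 1) measurable_const
  simpa only [lintegral_one, measure_univ, mul_one, h1] using this

lemma lintegral_outDensity {b : Belief E F k} (hb : Measurable b) (a : Collection E k) :
    ∫⁻ z, P.outDensity b a z ∂P.refSample = ∫⁻ q, b q ∂(P.refBelief k) := by
  have := a.markov
  have := P.lintegral_outLaw_eq hb a (h := fun _ => 1) measurable_const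
  simpa only [lintegral_one, measure_univ, mul_one, outLaw, withDensity_apply _ MeasurableSet.univ,
    Measure.restrict_univ] using this

lemma ae_outDensity_ne_top {b : Belief E F k} (hb : Measurable b) (a : Collection E k)
    (hfin : ∫⁻ q, b q ∂(P.refBelief k) ≠ ∞) :
    ∀ᵐ z ∂P.refSample, P.outDensity b a z ≠ ∞ := by
  rw [← P.lintegral_outDensity hb a] at hfin
  exact (ae_lt_top (P.measurable_outDensity_apply hb a) hfin).mono fun _ h => h.ne

lemma ae_outLaw_outDensity {b : Belief E F k} (hb : Measurable b) (a : Collection E k)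
    (hfin : ∫⁻ q, b q ∂(P.refBelief k) ≠ ∞) :
    ∀ᵐ z ∂(P.outLaw b a), P.outDensity b a z ≠ 0 ∧ P.outDensity b a z ≠ ∞ := by
  rw [outLaw, ae_withDensity_iff (P.measurable_outDensity_apply hb a)]
  exact (P.ae_outDensity_ne_top hb a hfin).mono fun _ h h0 => ⟨h0, h⟩

/-- The blank is an atom of `refSample`, so an almost everywhere statement holds there outright. -/
lemma ae_refX_of_ae_refSample {p : Sample E → Prop} (h : ∀ᵐ z ∂P.refSample, p z) :
    (∀ᵐ x ∂P.refX, p (Sum.inl x)) ∧ p (Sum.inr ()) := by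
  rw [refSample, ae_add_measure_iff] at h
  refine ⟨ae_of_ae_map measurable_inl.aemeasurable h.1, ?_⟩
  by_contra hc
  have h2 := measure_mono_null (s := {Sum.inr ()}) (fun z hz => by rw [hz]; exact hc) h.2
  have h3 : MeasurableSet ({Sum.inr ()} : Set (Sample E)) :=
    measurableSet_sum_iff.2
      ⟨by convert MeasurableSet.empty; ext; simp, MeasurableSet.of_discrete⟩
  rw [Measure.dirac_apply' _ h3] at h2
  simp at h2

/-- The belief update is a disintegration: drawing `Z_k` and then a point from the updated belief
state is the same as drawing from the belief state and making one step of the dynamics. -/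
lemma lintegral_outLaw_update {b : Belief E F k} (hb : Measurable b) (a : Collection E k)
    (hfin : ∫⁻ q, b q ∂(P.refBelief k) ≠ ∞) {H : Sample E → BeliefPoint E F (k + 1) → ℝ≥0∞}
    (hH : Measurable (Function.uncurry H)) :
    ∫⁻ z, ∫⁻ q, P.update b a z q * H z q ∂(P.refBelief (k + 1)) ∂(P.outLaw b a) =
      ∫⁻ q, b q * ∫⁻ n, P.next (H (sampleOut q.1 n)) q.1 q.2.1 (memoryOut q.1 n) q.2.2
        ∂(a.kernel (q.1, q.2.1)) ∂(P.refBelief k) := by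
  have hs : ∀ n, Measurable fun q : BeliefPoint E F k =>
      P.next (H (sampleOut q.1 n)) q.1 q.2.1 (memoryOut q.1 n) q.2.2 := fun n =>
    P.measurable_next (H := fun q : BeliefPoint E F k => H (sampleOut q.1 n))
      (hH.comp (((measurable_sampleOut.comp (f := fun q : BeliefPoint E F k => (q.1, n))
        (by fun_prop)).comp measurable_fst).prodMk measurable_snd)) (by fun_prop) (by fun_prop)
      (measurable_memoryOut.comp (f := fun q : BeliefPoint E F k => (q.1, n)) (by fun_prop))
      (by fun_prop)
  have hz : ∀ z, Measurable (H z) := fun z => hH.of_uncurry_left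
  have hm : Measurable fun z => ∫⁻ q, P.update b a z q * H z q ∂(P.refBelief (k + 1)) :=
    Measurable.lintegral_prod_right' (f := fun t : Sample E × BeliefPoint E F (k + 1) =>
      P.update b a t.1 t.2 * H t.1 t.2) ((P.measurable_update_apply hb a).mul hH)
  -- The normalizer cancels against the density of `Z_k` once it is finite; its zeros are harmless
  -- by `lintegral_mul_lintegral_mul_div`.
  have htop := P.ae_refX_of_ae_refSample (P.ae_outDensity_ne_top hb a hfin)
  rw [P.lintegral_belief_decision hb a hs, P.lintegral_outLaw hb a hm]
  congr 1
  · refine lintegral_congr_ae (htop.1.mono fun x hx => ?_)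
    simp only []
    rw [P.lintegral_update_inl hb a x (hz _)]
    exact lintegral_mul_lintegral_mul_div (measurable_prob_mul_right hb a true x) hx
  · rw [P.lintegral_update_blank hb a (hz _)]
    exact lintegral_mul_lintegral_mul_div (measurable_prob_mul hb a false) htop.2

lemma lintegral_update_eq_one {b : Belief E F k} (hb : Measurable b) (a : Collection E k)
    {z : Sample E} (h0 : P.outDensity b a z ≠ 0) (ht : P.outDensity b a z ≠ ∞) :
    ∫⁻ q, P.update b a z q ∂(P.refBelief (k + 1)) = 1 := by
  rcases z with x | u
  · have := P.lintegral_update_inl hb a x (H := fun _ => 1) measurable_const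
    simp only [mul_one, next_const] at this
    rw [this]
    exact ENNReal.div_self h0 ht
  · have := P.lintegral_update_blank hb a (H := fun _ => 1) measurable_const
    simp only [mul_one, next_const] at this
    rw [this]
    exact ENNReal.div_self h0 ht

/-- On the support of the updated belief, memory and data are complementary in the newest entry, and
the older entries come from a point in the support of the old belief. This is the inductive step for
knowing the discard times. -/
lemma update_ne_zero {b : Belief E F k} {a : Collection E k} {z : Sample E}
    {q : BeliefPoint E F (k + 1)} (h : P.update b a z q ≠ 0) :
    ((q.2.1 (Fin.last k)).isLeft = true ↔ z.isLeft = false) ∧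
      ∃ x y, b (x, Fin.init q.2.1, y) ≠ 0 := by
  rcases z with x | u <;> rcases hq : q.2.1 (Fin.last k) with x' | u'
  · simp [update, hq] at h
  · simp only [update, hq] at h
    refine ⟨by simp, x, Fin.init q.2.2, fun h0 => h ?_⟩
    simp [h0]
  · simp only [update, hq] at h
    refine ⟨by simp, x', Fin.init q.2.2, fun h0 => h ?_⟩
    simp [h0]
  · simp [update, hq] at h

/-! ## The laws of the private sequence -/

lemma lintegral_refBelief_priv {G : BeliefPoint E F k → ℝ≥0∞} (hG : Measurable G) :
    ∫⁻ q, G q ∂(P.refBelief k) =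
      ∫⁻ y, ∫⁻ r : E × Memory E k, G (r.1, r.2, y) ∂(P.refX.prod (P.refMemory k))
        ∂(P.refPriv k) := by
  have h1 : Measurable fun t : (E × Memory E k) × (Fin (k + 1) → F) => G (t.1.1, t.1.2, t.2) :=
    hG.comp (by fun_prop)
  rw [lintegral_lintegral_swap (f := fun y (r : E × Memory E k) => G (r.1, r.2, y))
    (hG.comp (by fun_prop)).aemeasurable, refBelief, lintegral_prod _ hG.aemeasurable,
    lintegral_prod _ h1.lintegral_prod_right'.aemeasurable]
  refine lintegral_congr fun x => ?_
  exact lintegral_prod _ (hG.comp measurable_prodMk_left).aemeasurable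

lemma lintegral_priorDensity {b : Belief E F k} (hb : Measurable b) :
    ∫⁻ y, P.priorDensity b y ∂(P.refPriv k) = ∫⁻ q, b q ∂(P.refBelief k) :=
  (P.lintegral_refBelief_priv hb).symm

lemma lintegral_outNum {b : Belief E F k} (hb : Measurable b) (a : Collection E k)
    (z : Sample E) : ∫⁻ y, P.outNum b a z y ∂(P.refPriv k) = P.outDensity b a z := by
  rcases z with x | u
  · exact (lintegral_prod_symm _ (measurable_prob_mul_right hb a true x).aemeasurable).symm
  · exact (P.lintegral_refBelief_priv (measurable_prob_mul hb a false)).symm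

/-- Total probability over the decision, since `a(1 | x, m) + a(0 | x, m) = 1`. -/
lemma lintegral_refSample_outNum {b : Belief E F k} (hb : Measurable b) (a : Collection E k)
    (y : Fin (k + 1) → F) : ∫⁻ z, P.outNum b a z y ∂P.refSample = P.priorDensity b y := by
  have h : ∀ n, Measurable fun r : E × Memory E k => a.prob n r.1 r.2 * b (r.1, r.2, y) :=
    fun n => (a.measurable_prob n).mul (hb.comp (by fun_prop))
  rw [P.lintegral_refSample (P.measurable_outNum_left hb a y),
    priorDensity]
  simp only [outNum]
  have e := lintegral_prod (μ := P.refX) (ν := P.refMemory k) _ (h true).aemeasurable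
  simp only at e
  rw [← e, ← lintegral_add_left (h true)]
  refine lintegral_congr fun r => ?_
  rw [← add_mul, a.prob_add_prob, one_mul]

/-- Where the density of `Z_k` is zero, so is the numerator for almost every `y`, because its
integral over `y` is that density. -/
lemma ae_ae_outDensity_mul_postDensity {b : Belief E F k} (hb : Measurable b)
    (a : Collection E k) (hfin : ∫⁻ q, b q ∂(P.refBelief k) ≠ ∞) :
    ∀ᵐ z ∂P.refSample, ∀ᵐ y ∂(P.refPriv k),
      P.outDensity b a z * P.postDensity b a z y = P.outNum b a z y := by
  refine (P.ae_outDensity_ne_top hb a hfin).mono fun z hz => ?_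
  rcases eq_or_ne (P.outDensity b a z) 0 with h0 | h0
  · have h1 := P.lintegral_outNum hb a z
    rw [h0, lintegral_eq_zero_iff (P.measurable_outNum_right hb a z)] at h1
    refine h1.mono fun y hy => ?_
    rw [h0, zero_mul]
    exact hy.symm
  · exact ae_of_all _ fun y => ENNReal.mul_div_cancel h0 hz

/-- The quantifiers are exchanged because the mixture identity is applied at fixed `y`, with `z`
random. -/
lemma ae_outDensity_mul_postDensity {b : Belief E F k} (hb : Measurable b) (a : Collection E k)
    (hfin : ∫⁻ q, b q ∂(P.refBelief k) ≠ ∞) :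
    ∀ᵐ y ∂(P.refPriv k), ∀ᵐ z ∂P.refSample,
      P.outDensity b a z * P.postDensity b a z y = P.outNum b a z y := by
  rw [Measure.ae_ae_comm (p := fun y z =>
    P.outDensity b a z * P.postDensity b a z y = P.outNum b a z y)
    (measurableSet_eq_fun (((P.measurable_outDensity_apply hb a).comp measurable_snd).mul
      (P.measurable_postDensity_apply hb a)) (P.measurable_outNum_apply hb a))]
  exact P.ae_ae_outDensity_mul_postDensity hb a hfin

/-- The joint law of `Z_k` and `Y^k`, disintegrated along `Z_k`. -/
lemma lintegral_outLaw_postDensity {b : Belief E F k} (hb : Measurable b) (a : Collection E k)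
    (hfin : ∫⁻ q, b q ∂(P.refBelief k) ≠ ∞) {G : Sample E → (Fin (k + 1) → F) → ℝ≥0∞}
    (hG : Measurable (Function.uncurry G)) :
    ∫⁻ z, ∫⁻ y, P.postDensity b a z y * G z y ∂(P.refPriv k) ∂(P.outLaw b a) =
      ∫⁻ q, b q * ∫⁻ n, G (sampleOut q.1 n) q.2.2 ∂(a.kernel (q.1, q.2.1)) ∂(P.refBelief k) := by
  have hs : ∀ n, Measurable fun q : BeliefPoint E F k => G (sampleOut q.1 n) q.2.2 := fun n =>
    hG.comp ((measurable_sampleOut.comp (f := fun q : BeliefPoint E F k => (q.1, n))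
      (by fun_prop)).prodMk measurable_snd.snd)
  have hGz : ∀ z, Measurable (G z) := fun z => hG.of_uncurry_left
  have hm : Measurable fun z => ∫⁻ y, P.postDensity b a z y * G z y ∂(P.refPriv k) :=
    Measurable.lintegral_prod_right' (f := fun t : Sample E × (Fin (k + 1) → F) =>
      P.postDensity b a t.1 t.2 * G t.1 t.2)
      (((P.measurable_postDensity_apply hb a).comp measurable_swap).mul hG)
  have hn : Measurable fun z => ∫⁻ y, P.outNum b a z y * G z y ∂(P.refPriv k) :=
    Measurable.lintegral_prod_right' (f := fun t : Sample E × (Fin (k + 1) → F) =>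
      P.outNum b a t.1 t.2 * G t.1 t.2)
      (((P.measurable_outNum_apply hb a).comp measurable_swap).mul hG)
  have e1 : ∫⁻ z, ∫⁻ y, P.postDensity b a z y * G z y ∂(P.refPriv k) ∂(P.outLaw b a) =
      ∫⁻ z, ∫⁻ y, P.outNum b a z y * G z y ∂(P.refPriv k) ∂P.refSample := by
    rw [outLaw, lintegral_withDensity_eq_lintegral_mul _ (P.measurable_outDensity_apply hb a) hm]
    refine lintegral_congr_ae ?_
    filter_upwards [P.ae_ae_outDensity_mul_postDensity hb a hfin] with z hz
    have hp : Measurable fun y => P.postDensity b a z y * G z y :=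
      (P.measurable_postDensity_right hb a z).mul (hGz z)
    rw [Pi.mul_apply, ← lintegral_const_mul _ hp]
    refine lintegral_congr_ae (hz.mono fun y hy => ?_)
    simp only []
    rw [← mul_assoc, hy]
  rw [e1, P.lintegral_refSample hn, P.lintegral_belief_decision hb a hs]
  congr 1
  · refine lintegral_congr fun x => ?_
    have h1 : Measurable fun r : Memory E k × (Fin (k + 1) → F) =>
        a.prob true x r.1 * b (x, r) * G (sampleOut x true) r.2 :=
      (measurable_prob_mul_right hb a true x).mul ((hGz _).comp measurable_snd)
    rw [lintegral_prod_symm _ h1.aemeasurable]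
    refine lintegral_congr fun y => ?_
    exact (lintegral_mul_const _
      ((measurable_prob_mul_right hb a true x).comp measurable_prodMk_right)).symm
  · have h1 : Measurable fun q : BeliefPoint E F k =>
        a.prob false q.1 q.2.1 * b q * G (sampleOut q.1 false) q.2.2 :=
      (measurable_prob_mul hb a false).mul (hs false)
    rw [P.lintegral_refBelief_priv h1]
    refine lintegral_congr fun y => ?_
    have h2 : Measurable fun r : E × Memory E k => a.prob false r.1 r.2 * b (r.1, r.2, y) :=
      (a.measurable_prob false).mul (hb.comp (by fun_prop))
    exact (lintegral_mul_const _ h2).symm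

/-- The posterior averages to the prior. This is the mean condition of `lintegral_klInt_eq_add`. -/
lemma ae_lintegral_outLaw_postDensity {b : Belief E F k} (hb : Measurable b) (a : Collection E k)
    (hfin : ∫⁻ q, b q ∂(P.refBelief k) ≠ ∞) :
    ∀ᵐ y ∂(P.refPriv k), ∫⁻ z, P.postDensity b a z y ∂(P.outLaw b a) = P.priorDensity b y := by
  refine (P.ae_outDensity_mul_postDensity hb a hfin).mono fun y hy => ?_
  rw [outLaw, lintegral_withDensity_eq_lintegral_mul _ (P.measurable_outDensity_apply hb a)
    (P.measurable_postDensity_left hb a y),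
    ← P.lintegral_refSample_outNum hb a]
  exact lintegral_congr_ae hy

lemma lintegral_postDensity {b : Belief E F k} (hb : Measurable b) (a : Collection E k)
    {z : Sample E} (h0 : P.outDensity b a z ≠ 0) (ht : P.outDensity b a z ≠ ∞) :
    ∫⁻ y, P.postDensity b a z y ∂(P.refPriv k) = 1 := by
  simp only [postDensity, div_eq_mul_inv]
  rw [lintegral_mul_const _ (P.measurable_outNum_right hb a z),
    P.lintegral_outNum hb a]
  exact ENNReal.mul_inv_cancel h0 ht

/-- The divergence averaged in `infoLoss`, in terms of densities. -/
def infoDensity (b : Belief E F k) (a : Collection E k) : ℝ≥0∞ :=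
  ∫⁻ z, ∫⁻ y, klInt (P.postDensity b a z y) (P.priorDensity b y) ∂(P.refPriv k) ∂(P.outLaw b a)

lemma infoLoss_eq {b : Belief E F k} (hb : P.IsBelief b) (a : Collection E k) :
    P.infoLoss b a = P.infoDensity b a := by
  obtain ⟨hm, h1, -⟩ := hb
  have hfin : ∫⁻ q, b q ∂(P.refBelief k) ≠ ∞ := by simp [h1]
  have hpost := P.measurable_postDensity_apply hm a
  have hprior := P.measurable_priorDensity_apply hm
  -- The posterior is dominated by the prior: where the prior is zero, the average of the posterior
  -- over `z` is zero, so the posterior vanishes for almost every `z`. Exchanging the quantifiers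
  -- gives the claim for almost every `z`.
  have hac : ∀ᵐ z ∂(P.outLaw b a), ∀ᵐ y ∂(P.refPriv k),
      P.priorDensity b y = 0 → P.postDensity b a z y = 0 := by
    have : IsProbabilityMeasure (P.outLaw b a) := P.isProbabilityMeasure_outLaw hm a h1
    rw [Measure.ae_ae_comm (p := fun z y => P.priorDensity b y = 0 → P.postDensity b a z y = 0)]
    · refine (P.ae_lintegral_outLaw_postDensity hm a hfin).mono fun y hy => ?_
      by_cases h0 : P.priorDensity b y = 0
      · rw [h0, lintegral_eq_zero_iff (P.measurable_postDensity_left hm a y)] at hy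
        exact hy.mono fun z hz _ => hz
      · exact ae_of_all _ fun z h => absurd h h0
    · exact (measurableSet_eq_fun (hprior.comp measurable_snd) measurable_const).imp
        (measurableSet_eq_fun (hpost.comp measurable_swap) measurable_const)
  refine lintegral_congr_ae ?_
  filter_upwards [hac, P.ae_outLaw_outDensity hm a hfin] with z hz hd
  rw [posteriorPriv_eq]
  refine klDiv_withDensity _ (P.measurable_postDensity_right hm a z) hprior ?_ ?_ hz
  · rw [P.lintegral_postDensity hm a hd.1 hd.2]
    simp
  · refine ((P.lintegral_priorDensity hm).trans h1).trans_ne ENNReal.one_ne_top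

/-- Integrating out the new state removes its transition density. What remains is the posterior of
`Y^k` times the private transition, since `Y_{k+1}` sees the past only through `Y_k`. -/
lemma priorDensity_update {b : Belief E F k} (hb : Measurable b) (a : Collection E k)
    (z : Sample E) (y : Fin (k + 1) → F) (v : F) :
    P.priorDensity (P.update b a z) (Fin.snoc y v) =
      P.postDensity b a z y * P.privDensity (y (Fin.last k)) v := by
  have hU : Measurable (P.update b a z) :=
    (P.measurable_update_apply hb a).comp measurable_prodMk_left
  have hs : ∀ x : E, Measurable fun x' => P.stateDensity (x, y (Fin.last k)) x' := fun x =>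
    P.measurable_stateDensity.of_uncurry_left
  have he : Measurable fun t : (Memory E k × Sample E) × E =>
      P.update b a z (extend t.1.1 t.1.2 y (t.2, v)) :=
    hU.comp (measurable_extend (by fun_prop) (by fun_prop) (by fun_prop) (by fun_prop))
  have h1 : P.priorDensity (P.update b a z) (Fin.snoc y v) =
      ∫⁻ m, ∫⁻ s, ∫⁻ x', P.update b a z (extend m s y (x', v)) ∂P.refX ∂P.refSample
        ∂(P.refMemory k) := by
    have hU' : Measurable fun r : E × Memory E (k + 1) =>
        P.update b a z (r.1, r.2, Fin.snoc y v) := hU.comp (by fun_prop)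
    rw [priorDensity, lintegral_prod_symm _ hU'.aemeasurable]
    exact lintegral_pi_snoc P.refSample k hU'.lintegral_prod_left'
  have h2 : ∀ m, ∫⁻ s, ∫⁻ x', P.update b a z (extend m s y (x', v)) ∂P.refX ∂P.refSample =
      _ := fun m => P.lintegral_refSample
        (he.comp (f := fun t : Sample E × E => ((m, t.1), t.2)) (by fun_prop)).lintegral_prod_right'
  rw [h1]
  simp_rw [h2]
  have h3 : ∀ (x : E) (c : ℝ≥0∞) (d : ℝ≥0∞) (e : ℝ≥0∞),
      ∫⁻ x', P.trans x (y (Fin.last k)) (x', v) * c * d / e ∂P.refX =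
        d * c * (P.privDensity (y (Fin.last k)) v / e) := by
    intro x c d e
    simp only [trans, div_eq_mul_inv, mul_assoc]
    rw [lintegral_mul_const _ (hs x), P.lintegral_stateDensity]
    ring
  rcases z with x | u
  · simp only [update_inl_inl, update_inl_inr, lintegral_zero, zero_add, h3]
    have : Measurable fun m => a.prob true x m * b (x, m, y) :=
      ((a.measurable_prob true).comp measurable_prodMk_left).mul (hb.comp (by fun_prop))
    rw [lintegral_mul_const _ this]
    simp only [postDensity, outNum, div_eq_mul_inv]
    ring
  · simp only [update_blank_inl, update_blank_inr, lintegral_zero, add_zero, h3]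
    have : Measurable fun r : E × Memory E k => a.prob false r.1 r.2 * b (r.1, r.2, y) :=
      (a.measurable_prob false).mul (hb.comp (by fun_prop))
    have e := lintegral_prod_symm (μ := P.refX) (ν := P.refMemory k) _ (this.mul_const
      (P.privDensity (y (Fin.last k)) v / P.outDensity b a (Sum.inr u))).aemeasurable
    rw [← e, lintegral_mul_const _ this]
    simp only [postDensity, outNum, div_eq_mul_inv]
    ring

end Model

/-! ### Policies as families of collections, and trajectories extended by one stage. -/

lemma measurable_lintegral_kernel {A B Θ : Type*} [MeasurableSpace A] [MeasurableSpace B]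
    [MeasurableSpace Θ] (κ : Kernel A B) [IsSFiniteKernel κ] {u : Θ → A} (hu : Measurable u)
    {f : Θ → B → ℝ≥0∞} (hf : Measurable (Function.uncurry f)) :
    Measurable fun t => ∫⁻ c, f t c ∂(κ (u t)) :=
  Measurable.lintegral_kernel_prod_right (κ := κ.comap u hu) hf

lemma lintegral_lintegral_mul_swap {A B : Type*} [MeasurableSpace A] [MeasurableSpace B]
    {μ : Measure A} {ν : Measure B} [SFinite μ] [SFinite ν] {v : B → ℝ≥0∞} (hv : Measurable v)
    {f : A → B → ℝ≥0∞} (hf : Measurable (Function.uncurry f)) :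
    ∫⁻ a, ∫⁻ c, v c * f a c ∂ν ∂μ = ∫⁻ c, v c * ∫⁻ a, f a c ∂μ ∂ν := by
  rw [lintegral_lintegral_swap ((hv.comp measurable_snd).mul hf).aemeasurable]
  refine lintegral_congr fun c => ?_
  exact lintegral_const_mul _ (hf.comp measurable_prodMk_right)

attribute [instance] SamplingPolicy.markov ReconPolicy.markov Collection.markov

/-- The policy collection that a sampling policy applies when the shared data are `z`. -/
def SamplingPolicy.collection (π : SamplingPolicy E) (k : ℕ) (z : Data E k) : Collection E k where
  kernel := (π.kernel k).comap (fun p => (z, p)) measurable_prodMk_left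
  markov := inferInstance

lemma SamplingPolicy.measurableCollection (π : SamplingPolicy E) (k : ℕ) :
    MeasurableCollection (π.collection k) := fun n => by
  exact Kernel.measurable_coe (π.kernel k) (measurableSet_singleton n)

section Trajectories

lemma dataOf_snoc {E F : Type*} {k : ℕ} (h : Fin k → Stage E F) (s : Stage E F) :
    dataOf (Fin.snoc h s : Fin (k + 1) → Stage E F) =
      Fin.snoc (dataOf h) (sampleOut s.1.1.1 s.1.2) := by
  ext i
  refine Fin.lastCases ?_ (fun j => ?_) i <;> simp [dataOf]

lemma memoryOf_snoc {E F : Type*} {k : ℕ} (h : Fin k → Stage E F) (s : Stage E F) :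
    memoryOf (Fin.snoc h s : Fin (k + 1) → Stage E F) =
      Fin.snoc (memoryOf h) (memoryOut s.1.1.1 s.1.2) := by
  ext i
  refine Fin.lastCases ?_ (fun j => ?_) i <;> simp [memoryOf]

lemma privOf_snoc {E F : Type*} {k : ℕ} (h : Fin k → Stage E F) (s : Stage E F) :
    privOf (Fin.snoc h s : Fin (k + 1) → Stage E F) = Fin.snoc (privOf h) s.1.1.2 := by
  ext i
  refine Fin.lastCases ?_ (fun j => ?_) i <;> simp [privOf]

lemma reconOf_snoc {E F : Type*} {k : ℕ} (h : Fin k → Stage E F) (s : Stage E F) :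
    reconOf (Fin.snoc h s : Fin (k + 1) → Stage E F) = Fin.snoc (reconOf h) s.2 := by
  ext i
  refine Fin.lastCases ?_ (fun j => ?_) i <;> simp [reconOf]

lemma measurable_privOf {k : ℕ} :
    Measurable (privOf : (Fin k → Stage E F) → Fin k → F) := by
  unfold privOf
  fun_prop

end Trajectories

/-! ### Belief states generated by a sampling policy. -/

namespace Model

variable (P : Model E F)

/-- The belief state associated with the shared data under a sampling policy. -/
def policyBelief (π : SamplingPolicy E) : ∀ k : ℕ, Data E k → Belief E F k
  | 0, _ => P.initBelief
  | k + 1, z => P.update (policyBelief π k (Fin.init z)) (π.collection k (Fin.init z))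
      (z (Fin.last k))

lemma policyBelief_snoc (π : SamplingPolicy E) (k : ℕ) (z : Data E k) (s : Sample E) :
    P.policyBelief π (k + 1) (Fin.snoc z s) =
      P.update (P.policyBelief π k z) (π.collection k z) s := by
  simp [policyBelief]

lemma measurable_policyBelief (π : SamplingPolicy E) (k : ℕ) :
    Measurable (Function.uncurry (P.policyBelief π k)) := by
  induction k with
  | zero => exact P.measurable_initDensity.comp (by fun_prop)
  | succ k ih =>
    have h1 : Measurable fun p : Data E (k + 1) × BeliefPoint E F (k + 1) =>
      (Fin.init p.1 : Data E k) := measurable_fin_init.comp measurable_fst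
    exact (P.measurable_update ih (π.measurableCollection k)).comp
      (f := fun p : Data E (k + 1) × BeliefPoint E F (k + 1) =>
        (((Fin.init p.1 : Data E k), p.1 (Fin.last k)), p.2)) (by fun_prop)

/-- The times of discard are exactly the blanks in the data. This supplies the set required by
`IsBelief`. -/
lemma policyBelief_ne_zero (π : SamplingPolicy E) {k : ℕ} {z : Data E k} {q : BeliefPoint E F k}
    (h : P.policyBelief π k z q ≠ 0) (i : Fin k) :
    (q.2.1 i).isLeft = true ↔ (z i).isLeft = false := by
  induction k with
  | zero => exact i.elim0
  | succ k ih =>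
    obtain ⟨h1, x, y, h2⟩ := P.update_ne_zero h
    refine Fin.lastCases h1 (fun j => ?_) i
    simpa [Fin.init] using ih h2 j

/-! ## Integrals along the closed loop -/

lemma measurable_envDensity (k : ℕ) : Measurable (Function.uncurry
    fun (h : Fin (k + 1) → Stage E F) (w : E × F) =>
      P.stateDensity (h (Fin.last k)).1.1 w.1 * P.privDensity (h (Fin.last k)).1.1.2 w.2) :=
  P.measurable_trans (x := fun t : (Fin (k + 1) → Stage E F) × (E × F) =>
    (t.1 (Fin.last k)).1.1.1) (y := fun t => (t.1 (Fin.last k)).1.1.2) (w := Prod.snd)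
    (by fun_prop) (by fun_prop) (by fun_prop)

lemma lintegral_envKernel_zero (h : Fin 0 → Stage E F) {G : E × F → ℝ≥0∞} (hG : Measurable G) :
    ∫⁻ w, G w ∂(P.envKernel 0 h) = ∫⁻ w, P.initDensity w * G w ∂(P.refX.prod P.refY) := by
  rw [envKernel, Kernel.const_apply,
    lintegral_withDensity_eq_lintegral_mul _ P.measurable_initDensity hG]
  rfl

lemma lintegral_envKernel_snoc {k : ℕ} (h : Fin k → Stage E F) (s : Stage E F)
    {G : E × F → ℝ≥0∞} (hG : Measurable G) :
    ∫⁻ w, G w ∂(P.envKernel (k + 1) (Fin.snoc h s)) =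
      ∫⁻ w, P.trans s.1.1.1 s.1.1.2 w * G w ∂(P.refX.prod P.refY) := by
  rw [envKernel, Kernel.lintegral_withDensity _ (P.measurable_envDensity k) _ hG]
  simp [trans]

instance (k : ℕ) : IsMarkovKernel (P.envKernel k) := by
  constructor
  intro h
  constructor
  rw [← lintegral_one]
  cases k with
  | zero =>
    rw [P.lintegral_envKernel_zero h measurable_const]
    simpa using P.lintegral_initDensity
  | succ k =>
    have e : h = Fin.snoc (Fin.init h) (h (Fin.last k)) := (Fin.snoc_init_self h).symm
    rw [e, P.lintegral_envKernel_snoc _ _ measurable_const]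
    simpa using P.lintegral_trans _ _

variable (π : SamplingPolicy E) (ρ : ReconPolicy E)

instance (k : ℕ) : IsMarkovKernel (P.stepKernel π ρ k) := by
  unfold stepKernel
  infer_instance

instance (k : ℕ) : IsProbabilityMeasure (P.law π ρ k) := by
  induction k with
  | zero => unfold law; infer_instance
  | succ k ih =>
    unfold law
    exact Measure.isProbabilityMeasure_map (measurable_snoc k).aemeasurable

lemma lintegral_law_succ {k : ℕ} {G : (Fin (k + 1) → Stage E F) → ℝ≥0∞} (hG : Measurable G) :
    ∫⁻ h, G h ∂(P.law π ρ (k + 1)) =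
      ∫⁻ h, ∫⁻ w, ∫⁻ n, ∫⁻ v, G (Fin.snoc h ((w, n), v))
        ∂(ρ.kernel k (Fin.snoc (dataOf h) (sampleOut w.1 n), reconOf h))
        ∂((π.collection k (dataOf h)).kernel (w.1, memoryOf h))
        ∂(P.envKernel k h) ∂(P.law π ρ k) := by
  have hs := hG.comp (measurable_snoc (A := Stage E F) k)
  have hf : Measurable fun p : (Fin k → Stage E F) × Stage E F => G (Fin.snoc p.1 p.2) := hs
  rw [law, lintegral_map hG (measurable_snoc k), Measure.lintegral_compProd hf]
  refine lintegral_congr fun h => ?_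
  have hh : Measurable fun s : Stage E F => G (Fin.snoc h s) := hf.comp measurable_prodMk_left
  rw [stepKernel, Kernel.lintegral_compProd _ _ _ hh, Kernel.lintegral_compProd]
  · rfl
  · exact Measurable.lintegral_kernel_prod_right'
      (κ := ((ρ.kernel k).comap reconInfo measurable_reconInfo).comap (fun c => (h, c))
        measurable_prodMk_left) hh

/-- At time zero the memory and the past private sequence are empty tuples, whose reference measures
are Dirac masses. The arguments `m` and `y` merely name the unique points. -/
lemma lintegral_refBelief_zero {G : BeliefPoint E F 0 → ℝ≥0∞} (hG : Measurable G)
    (m : Memory E 0) (y : Fin 0 → F) :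
    ∫⁻ q, G q ∂(P.refBelief 0) =
      ∫⁻ w, G (w.1, m, Fin.snoc y w.2) ∂(P.refX.prod P.refY) := by
  have hw : Measurable fun w : E × F => G (w.1, m, Fin.snoc y w.2) :=
    hG.comp (measurable_fst.prodMk
      (measurable_const.prodMk (measurable_fin_snoc measurable_const measurable_snd)))
  rw [refBelief, lintegral_prod _ hG.aemeasurable, lintegral_prod _ hw.aemeasurable]
  refine lintegral_congr fun x => ?_
  have h1 : Measurable fun r : Memory E 0 × (Fin 1 → F) => G (x, r) :=
    hG.comp measurable_prodMk_left
  have h2 : Measurable fun v : Fin 1 → F => G (x, m, v) := h1.comp measurable_prodMk_left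
  have h3 : Measurable fun u : Fin 0 → F => ∫⁻ v, G (x, m, Fin.snoc u v) ∂P.refY :=
    Measurable.lintegral_prod_right' (f := fun t : (Fin 0 → F) × F => G (x, m, Fin.snoc t.1 t.2))
      (h2.comp (measurable_snoc 0))
  rw [lintegral_prod _ h1.aemeasurable, refMemory, Measure.pi_of_empty _ m,
    lintegral_dirac' _ h1.lintegral_prod_right', refPriv, lintegral_pi_snoc _ _ h2,
    Measure.pi_of_empty _ y, lintegral_dirac' _ h3]

/-- Test functions of the shared data, the reconstructions and the arguments of the belief state
are integrated by the belief states of the policy. -/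
def IsBeliefAt (k : ℕ) : Prop :=
  ∀ f : Data E k → (Fin k → E) → BeliefPoint E F k → ℝ≥0∞,
    (Measurable fun t : (Data E k × (Fin k → E)) × BeliefPoint E F k => f t.1.1 t.1.2 t.2) →
    ∫⁻ h, ∫⁻ w, f (dataOf h) (reconOf h) (w.1, memoryOf h, Fin.snoc (privOf h) w.2)
        ∂(P.envKernel k h) ∂(P.law π ρ k) =
      ∫⁻ h, ∫⁻ q, P.policyBelief π k (dataOf h) q * f (dataOf h) (reconOf h) q ∂(P.refBelief k)
        ∂(P.law π ρ k)

lemma isBeliefAt_zero : P.IsBeliefAt π ρ 0 := by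
  intro f hf
  refine lintegral_congr fun h => ?_
  have hfz : Measurable fun q => f (dataOf h) (reconOf h) q :=
    hf.comp (measurable_prodMk_left (x := (dataOf h, reconOf h)))
  have hw : Measurable fun w : E × F =>
      f (dataOf h) (reconOf h) (w.1, memoryOf h, Fin.snoc (privOf h) w.2) :=
    hfz.comp (measurable_fst.prodMk
      (measurable_const.prodMk (measurable_fin_snoc measurable_const measurable_snd)))
  have hq : Measurable fun q =>
      P.policyBelief π 0 (dataOf h) q * f (dataOf h) (reconOf h) q :=
    ((P.measurable_policyBelief π 0).of_uncurry_left).mul hfz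
  rw [P.lintegral_envKernel_zero h hw, P.lintegral_refBelief_zero hq (memoryOf h) (privOf h)]
  rfl

variable {P π ρ} {k : ℕ}

/-- Tested on indicators of data events, the total mass of the belief has the same integral as the
constant `1` over every event. -/
lemma IsBeliefAt.ae_lintegral_eq_one (hk : P.IsBeliefAt π ρ k) :
    ∀ᵐ h ∂(P.law π ρ k), ∫⁻ q, P.policyBelief π k (dataOf h) q ∂(P.refBelief k) = 1 := by
  have hm : Measurable fun z : Data E k => ∫⁻ q, P.policyBelief π k z q ∂(P.refBelief k) :=
    (P.measurable_policyBelief π k).lintegral_prod_right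
  have : IsProbabilityMeasure ((P.law π ρ k).map dataOf) :=
    Measure.isProbabilityMeasure_map measurable_dataOf.aemeasurable
  refine ae_of_ae_map measurable_dataOf.aemeasurable
    (p := fun z => ∫⁻ q, P.policyBelief π k z q ∂(P.refBelief k) = 1) ?_
  refine ae_eq_of_forall_setLIntegral_eq_of_sigmaFinite hm measurable_const fun B hB _ => ?_
  have h1 := hk (fun z _ _ => B.indicator 1 z)
    ((measurable_one.indicator hB).comp measurable_fst.fst)
  simp only [lintegral_const, measure_univ, mul_one] at h1
  have h2 : ∀ z : Data E k, ∫⁻ q, P.policyBelief π k z q * B.indicator 1 z ∂(P.refBelief k) =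
      B.indicator (fun z => ∫⁻ q, P.policyBelief π k z q ∂(P.refBelief k)) z := by
    intro z
    by_cases hz : z ∈ B <;> simp [hz]
  simp_rw [h2] at h1
  rw [← lintegral_indicator hB, ← lintegral_indicator hB,
    lintegral_map (hm.indicator hB) measurable_dataOf,
    lintegral_map (measurable_const.indicator hB) measurable_dataOf, ← h1]
  rfl

/-- One step of the closed loop, in terms of the belief states. -/
lemma IsBeliefAt.lintegral_step (hk : P.IsBeliefAt π ρ k)
    {f : Data E k → (Fin k → E) → BeliefPoint E F k → Bool → E → ℝ≥0∞}
    (hf : Measurable fun t : (((Data E k × (Fin k → E)) × BeliefPoint E F k) × Bool) × E =>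
      f t.1.1.1.1 t.1.1.1.2 t.1.1.2 t.1.2 t.2) :
    ∫⁻ h, ∫⁻ w, ∫⁻ n, ∫⁻ v,
        f (dataOf h) (reconOf h) (w.1, memoryOf h, Fin.snoc (privOf h) w.2) n v
        ∂(ρ.kernel k (Fin.snoc (dataOf h) (sampleOut w.1 n), reconOf h))
        ∂((π.collection k (dataOf h)).kernel (w.1, memoryOf h))
        ∂(P.envKernel k h) ∂(P.law π ρ k) =
      ∫⁻ h, ∫⁻ q, P.policyBelief π k (dataOf h) q * ∫⁻ n, ∫⁻ v, f (dataOf h) (reconOf h) q n v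
        ∂(ρ.kernel k (Fin.snoc (dataOf h) (sampleOut q.1 n), reconOf h))
        ∂((π.collection k (dataOf h)).kernel (q.1, q.2.1)) ∂(P.refBelief k) ∂(P.law π ρ k) := by
  -- Once decision and reconstruction are averaged out, what is left depends only on the data, the
  -- past reconstructions and the belief point, so it is an admissible test function.
  refine hk (fun z r q => ∫⁻ n, ∫⁻ v, f z r q n v
    ∂(ρ.kernel k (Fin.snoc z (sampleOut q.1 n), r)) ∂((π.collection k z).kernel (q.1, q.2.1))) ?_
  have h1 : Measurable fun t : ((Data E k × (Fin k → E)) × BeliefPoint E F k) × Bool =>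
      ∫⁻ v, f t.1.1.1 t.1.1.2 t.1.2 t.2 v
        ∂(ρ.kernel k (Fin.snoc t.1.1.1 (sampleOut t.1.2.1 t.2), t.1.1.2)) := by
    refine measurable_lintegral_kernel (ρ.kernel k) (u := fun
      t : ((Data E k × (Fin k → E)) × BeliefPoint E F k) × Bool =>
      ((Fin.snoc t.1.1.1 (sampleOut t.1.2.1 t.2) : Data E (k + 1)), t.1.1.2)) ?_ hf
    have h2 : Measurable fun t : ((Data E k × (Fin k → E)) × BeliefPoint E F k) × Bool =>
      sampleOut t.1.2.1 t.2 :=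
    measurable_sampleOut.comp (measurable_fst.snd.fst.prodMk measurable_snd)
    exact (measurable_fin_snoc (by fun_prop) h2).prodMk (by fun_prop)
  exact measurable_lintegral_kernel (π.kernel k) (u := fun
      t : (Data E k × (Fin k → E)) × BeliefPoint E F k => (t.1.1, t.2.1, t.2.2.1))
      (by fun_prop) h1

/-- The law of the data and the reconstructions after one more step. -/
lemma IsBeliefAt.lintegral_data_recon (hk : P.IsBeliefAt π ρ k)
    {G : Data E (k + 1) → (Fin (k + 1) → E) → ℝ≥0∞} (hG : Measurable (Function.uncurry G)) :
    ∫⁻ h, G (dataOf h) (reconOf h) ∂(P.law π ρ (k + 1)) =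
      ∫⁻ h, ∫⁻ s, ∫⁻ v, G (Fin.snoc (dataOf h) s) (Fin.snoc (reconOf h) v)
        ∂(ρ.kernel k (Fin.snoc (dataOf h) s, reconOf h))
        ∂(P.outLaw (P.policyBelief π k (dataOf h)) (π.collection k (dataOf h)))
        ∂(P.law π ρ k) := by
  have hb := fun z => (P.measurable_policyBelief π k).of_uncurry_left (x := z)
  have hGm : Measurable fun h : Fin (k + 1) → Stage E F => G (dataOf h) (reconOf h) :=
    hG.comp (measurable_dataOf.prodMk measurable_reconOf)
  rw [P.lintegral_law_succ π ρ hGm]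
  simp only [dataOf_snoc, reconOf_snoc]
  have hm : Measurable fun t : (((Data E k × (Fin k → E)) × BeliefPoint E F k) × Bool) × E =>
      G (Fin.snoc t.1.1.1.1 (sampleOut t.1.1.2.1 t.1.2)) (Fin.snoc t.1.1.1.2 t.2) := by
    have h2 : Measurable fun t : (((Data E k × (Fin k → E)) × BeliefPoint E F k) × Bool) × E =>
      sampleOut t.1.1.2.1 t.1.2 := measurable_sampleOut.comp
        (measurable_fst.fst.snd.fst.prodMk measurable_fst.snd)
    exact hG.comp ((measurable_fin_snoc (by fun_prop) h2).prodMk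
      (measurable_fin_snoc (by fun_prop) (by fun_prop)))
  refine (hk.lintegral_step (f := fun z r q n v =>
    G (Fin.snoc z (sampleOut q.1 n)) (Fin.snoc r v)) hm).trans ?_
  refine lintegral_congr fun h => ?_
  have hs : Measurable fun s => ∫⁻ v, G (Fin.snoc (dataOf h) s) (Fin.snoc (reconOf h) v)
      ∂(ρ.kernel k (Fin.snoc (dataOf h) s, reconOf h)) := by
    refine measurable_lintegral_kernel (ρ.kernel k) (u := fun s : Sample E =>
      ((Fin.snoc (dataOf h) s : Data E (k + 1)), reconOf h))
      ((measurable_fin_snoc measurable_const measurable_id).prodMk measurable_const) ?_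
    exact hG.comp ((measurable_fin_snoc measurable_const measurable_fst).prodMk
      (measurable_fin_snoc measurable_const measurable_snd))
  rw [P.lintegral_outLaw_eq (hb _) _ hs]

lemma IsBeliefAt.lintegral_data (hk : P.IsBeliefAt π ρ k)
    {G : Data E (k + 1) → ℝ≥0∞} (hG : Measurable G) :
    ∫⁻ h, G (dataOf h) ∂(P.law π ρ (k + 1)) =
      ∫⁻ h, ∫⁻ s, G (Fin.snoc (dataOf h) s)
        ∂(P.outLaw (P.policyBelief π k (dataOf h)) (π.collection k (dataOf h)))
        ∂(P.law π ρ k) := by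
  have := hk.lintegral_data_recon (G := fun z _ => G z) (hG.comp measurable_fst)
  simpa only [lintegral_const, measure_univ, mul_one] using this

/-- Given the data and the past reconstructions, the new reconstruction is drawn without reference
to the hidden variables, so averaging over it commutes with integration against the updated belief.
The disintegration `lintegral_outLaw_update` then turns the right side into one step of the dynamics
from the belief at time `k`, which is also what unrolling the left side gives. -/
lemma IsBeliefAt.succ (hk : P.IsBeliefAt π ρ k) : P.IsBeliefAt π ρ (k + 1) := by
  intro f hf
  have hb := fun z => (P.measurable_policyBelief π k).of_uncurry_left (x := z)
  have hfz : ∀ z r, Measurable (f z r) := fun z r =>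
    hf.comp (measurable_const.prodMk measurable_id : Measurable fun q => ((z, r), q))
  -- the test function of the next belief state
  have hf1 : Measurable fun t : (Data E (k + 1) × (Fin (k + 1) → E)) =>
      ∫⁻ q, P.policyBelief π (k + 1) t.1 q * f t.1 t.2 q ∂(P.refBelief (k + 1)) :=
    Measurable.lintegral_prod_right'
      (f := fun t : (Data E (k + 1) × (Fin (k + 1) → E)) × BeliefPoint E F (k + 1) =>
        P.policyBelief π (k + 1) t.1.1 t.2 * f t.1.1 t.1.2 t.2)
      ((measurable_apply_apply (P.measurable_policyBelief π (k + 1)) (by fun_prop)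
        (by fun_prop)).mul hf)
  refine Eq.trans ?_ (hk.lintegral_data_recon (G := fun z r =>
    ∫⁻ q, P.policyBelief π (k + 1) z q * f z r q ∂(P.refBelief (k + 1))) hf1).symm
  -- averaging over the reconstruction
  have hfv : ∀ (z : Data E k) (r : Fin k → E), Measurable fun
      t : (Sample E × BeliefPoint E F (k + 1)) × E =>
      f (Fin.snoc z t.1.1) (Fin.snoc r t.2) t.1.2 := fun z r =>
    hf.comp (((measurable_fin_snoc measurable_const measurable_fst.fst).prodMk
      (measurable_fin_snoc measurable_const measurable_snd)).prodMk measurable_fst.snd)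
  have hH : ∀ (z : Data E k) (r : Fin k → E), Measurable (Function.uncurry
      fun (s : Sample E) (q : BeliefPoint E F (k + 1)) =>
      ∫⁻ v, f (Fin.snoc z s) (Fin.snoc r v) q ∂(ρ.kernel k (Fin.snoc z s, r))) := fun z r =>
    measurable_lintegral_kernel (ρ.kernel k) (u := fun t : Sample E × BeliefPoint E F (k + 1) =>
      ((Fin.snoc z t.1 : Data E (k + 1)), r))
      ((measurable_fin_snoc measurable_const measurable_fst).prodMk measurable_const) (hfv z r)
  have hR : ∀ᵐ h ∂(P.law π ρ k),
      ∫⁻ s, ∫⁻ v, ∫⁻ q, P.policyBelief π (k + 1) (Fin.snoc (dataOf h) s) q *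
          f (Fin.snoc (dataOf h) s) (Fin.snoc (reconOf h) v) q ∂(P.refBelief (k + 1))
        ∂(ρ.kernel k (Fin.snoc (dataOf h) s, reconOf h))
        ∂(P.outLaw (P.policyBelief π k (dataOf h)) (π.collection k (dataOf h))) =
      ∫⁻ q, P.policyBelief π k (dataOf h) q * ∫⁻ n, ∫⁻ v,
          P.next (f (Fin.snoc (dataOf h) (sampleOut q.1 n)) (Fin.snoc (reconOf h) v)) q.1 q.2.1
            (memoryOut q.1 n) q.2.2
        ∂(ρ.kernel k (Fin.snoc (dataOf h) (sampleOut q.1 n), reconOf h))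
        ∂((π.collection k (dataOf h)).kernel (q.1, q.2.1)) ∂(P.refBelief k) := by
    filter_upwards [hk.ae_lintegral_eq_one] with h hh
    have e1 : ∀ s, ∫⁻ v, ∫⁻ q, P.policyBelief π (k + 1) (Fin.snoc (dataOf h) s) q *
          f (Fin.snoc (dataOf h) s) (Fin.snoc (reconOf h) v) q ∂(P.refBelief (k + 1))
        ∂(ρ.kernel k (Fin.snoc (dataOf h) s, reconOf h)) =
        ∫⁻ q, P.update (P.policyBelief π k (dataOf h)) (π.collection k (dataOf h)) s q *
          ∫⁻ v, f (Fin.snoc (dataOf h) s) (Fin.snoc (reconOf h) v) q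
            ∂(ρ.kernel k (Fin.snoc (dataOf h) s, reconOf h)) ∂(P.refBelief (k + 1)) := fun s => by
      rw [policyBelief_snoc]
      exact lintegral_lintegral_mul_swap
        ((P.measurable_update_apply (hb _) _).comp measurable_prodMk_left)
        ((hfv (dataOf h) (reconOf h)).comp ((measurable_const.prodMk measurable_snd).prodMk
          measurable_fst))
    simp_rw [e1]
    rw [P.lintegral_outLaw_update (hb _) _ (by simp [hh]) (hH (dataOf h) (reconOf h))]
    refine lintegral_congr fun q => ?_
    congr 1
    refine lintegral_congr fun n => ?_
    exact (lintegral_lintegral_mul_swap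
      (P.measurable_trans measurable_const measurable_const measurable_id)
      (f := fun v w => f (Fin.snoc (dataOf h) (sampleOut q.1 n)) (Fin.snoc (reconOf h) v)
        (extend q.2.1 (memoryOut q.1 n) q.2.2 w))
      ((hfv (dataOf h) (reconOf h)).comp ((measurable_const.prodMk
        (measurable_extend measurable_const measurable_const measurable_const
          measurable_snd)).prodMk measurable_fst))).symm
  rw [lintegral_congr_ae hR]
  have hE : Measurable fun h : Fin (k + 1) → Stage E F => ∫⁻ w, f (dataOf h) (reconOf h)
      (w.1, memoryOf h, Fin.snoc (privOf h) w.2) ∂(P.envKernel (k + 1) h) :=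
    measurable_lintegral_kernel (P.envKernel (k + 1)) (u := fun h => h) measurable_id
      (hf.comp (((measurable_dataOf.comp measurable_fst).prodMk
        (measurable_reconOf.comp measurable_fst)).prodMk (measurable_snd.fst.prodMk
          ((measurable_memoryOf.comp measurable_fst).prodMk
            (measurable_fin_snoc (measurable_privOf.comp measurable_fst) measurable_snd.snd)))))
  rw [P.lintegral_law_succ π ρ hE]
  have hN : Measurable fun t : (((Data E k × (Fin k → E)) × BeliefPoint E F k) × Bool) × E =>
      P.next (f (Fin.snoc t.1.1.1.1 (sampleOut t.1.1.2.1 t.1.2)) (Fin.snoc t.1.1.1.2 t.2))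
        t.1.1.2.1 t.1.1.2.2.1 (memoryOut t.1.1.2.1 t.1.2) t.1.1.2.2.2 := by
    have h2 : Measurable fun t : (((Data E k × (Fin k → E)) × BeliefPoint E F k) × Bool) × E =>
      sampleOut t.1.1.2.1 t.1.2 := measurable_sampleOut.comp
        (measurable_fst.fst.snd.fst.prodMk measurable_fst.snd)
    have h3 : Measurable fun t : (((Data E k × (Fin k → E)) × BeliefPoint E F k) × Bool) × E =>
      memoryOut t.1.1.2.1 t.1.2 := measurable_memoryOut.comp
        (measurable_fst.fst.snd.fst.prodMk measurable_fst.snd)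
    refine P.measurable_next (H := fun
      t : (((Data E k × (Fin k → E)) × BeliefPoint E F k) × Bool) × E =>
      f (Fin.snoc t.1.1.1.1 (sampleOut t.1.1.2.1 t.1.2)) (Fin.snoc t.1.1.1.2 t.2))
      ?_ (by fun_prop) (by fun_prop) h3 (by fun_prop)
    exact hf.comp (((measurable_fin_snoc (by fun_prop) (h2.comp measurable_fst)).prodMk
      (measurable_fin_snoc (by fun_prop) (by fun_prop))).prodMk measurable_snd)
  refine Eq.trans ?_ (hk.lintegral_step (f := fun z r q n v =>
    P.next (f (Fin.snoc z (sampleOut q.1 n)) (Fin.snoc r v)) q.1 q.2.1 (memoryOut q.1 n) q.2.2) hN)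
  refine lintegral_congr fun h => lintegral_congr fun w => lintegral_congr fun n =>
    lintegral_congr fun v => ?_
  rw [P.lintegral_envKernel_snoc]
  · simp only [dataOf_snoc, reconOf_snoc, memoryOf_snoc, privOf_snoc]
    simp [next, extend]
  · exact (hfz _ _).comp (measurable_fst.prodMk
      (measurable_const.prodMk (measurable_fin_snoc measurable_const measurable_snd)))

variable (P π ρ)

lemma isBeliefAt (k : ℕ) : P.IsBeliefAt π ρ k := by
  induction k with
  | zero => exact P.isBeliefAt_zero π ρ
  | succ k ih => exact ih.succ

/-- The belief states of a policy are the conditional densities. -/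
lemma isConditionalDensity_policyBelief (k : ℕ) :
    P.IsConditionalDensity π ρ k (P.policyBelief π k) := by
  intro B C hB hC
  have hb := P.measurable_policyBelief π k
  have hset : MeasurableSet {h : Fin (k + 1) → Stage E F |
      dataOf (Fin.init h : Fin k → Stage E F) ∈ B ∧
      ((h (Fin.last k)).1.1.1, memoryOf (Fin.init h : Fin k → Stage E F), privOf h) ∈ C} := by
    have hi := measurable_fin_init (A := Stage E F) (k := k)
    refine (hB.preimage (measurable_dataOf.comp hi)).inter (hC.preimage ?_)
    exact (by fun_prop : Measurable fun h : Fin (k + 1) → Stage E F =>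
      (h (Fin.last k)).1.1.1).prodMk ((measurable_memoryOf.comp hi).prodMk measurable_privOf)
  have hc : Measurable fun z : Data E k => ∫⁻ q in C, P.policyBelief π k z q ∂(P.refBelief k) :=
    hb.lintegral_prod_right
  rw [← lintegral_indicator_one hset, P.lintegral_law_succ π ρ (measurable_one.indicator hset)]
  have h1 := P.isBeliefAt π ρ k (fun z _ q => B.indicator 1 z * C.indicator 1 q)
    (((measurable_one.indicator hB).comp measurable_fst.fst).mul
      ((measurable_one.indicator hC).comp measurable_snd))
  -- The event does not involve the decision and the reconstruction of the last stage, so their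
  -- kernels integrate to one.
  have h2 : ∀ (h : Fin k → Stage E F) (w : E × F) (n : Bool) (v : E),
      Set.indicator {h : Fin (k + 1) → Stage E F |
        dataOf (Fin.init h : Fin k → Stage E F) ∈ B ∧
        ((h (Fin.last k)).1.1.1, memoryOf (Fin.init h : Fin k → Stage E F), privOf h) ∈ C}
        (1 : (Fin (k + 1) → Stage E F) → ℝ≥0∞) (Fin.snoc h ((w, n), v)) =
      B.indicator 1 (dataOf h) * C.indicator 1 (w.1, memoryOf h, Fin.snoc (privOf h) w.2) := by
    intro h w n v
    classical
    simp only [Set.indicator_apply, Set.mem_ofPred_eq, Fin.init_snoc, Fin.snoc_last, privOf_snoc]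
    by_cases hz : dataOf h ∈ B <;> simp [hz]
  simp only [h2, lintegral_const, measure_univ, mul_one]
  rw [h1, ← lintegral_indicator hB, lintegral_map (hc.indicator hB) measurable_dataOf]
  refine lintegral_congr fun h => ?_
  by_cases hz : dataOf h ∈ B
  · simp only [hz, Set.indicator_of_mem, Pi.one_apply, one_mul]
    rw [← lintegral_indicator hC]
    refine lintegral_congr fun q => ?_
    by_cases hq : q ∈ C <;> simp [hq]
  · simp [hz]

end Model

/-! ### The private marginal, and mutual information through densities. -/

namespace Model

variable (P : Model E F)

/-- The density of `Y^k`. -/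
def privMarginal : ∀ k : ℕ, (Fin (k + 1) → F) → ℝ≥0∞
  | 0, y => ∫⁻ x, P.initDensity (x, y 0) ∂P.refX
  | k + 1, y => privMarginal k (Fin.init y) *
      P.privDensity ((Fin.init y : Fin (k + 1) → F) (Fin.last k)) (y (Fin.last (k + 1)))

lemma privMarginal_snoc (k : ℕ) (y : Fin (k + 1) → F) (v : F) :
    P.privMarginal (k + 1) (Fin.snoc y v) =
      P.privMarginal k y * P.privDensity (y (Fin.last k)) v := by
  simp [privMarginal]

lemma measurable_privMarginal (k : ℕ) : Measurable (P.privMarginal k) := by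
  induction k with
  | zero =>
    exact Measurable.lintegral_prod_left' (f := fun t : E × (Fin 1 → F) =>
      P.initDensity (t.1, t.2 0)) (P.measurable_initDensity.comp (by fun_prop))
  | succ k ih =>
    have hi := measurable_fin_init (A := F) (k := k + 1)
    exact (ih.comp hi).mul (P.measurable_privDensity.comp
      (((measurable_pi_apply _).comp hi).prodMk (measurable_pi_apply _)))

lemma lintegral_privMarginal (k : ℕ) :
    ∫⁻ y, P.privMarginal k y ∂(P.refPriv k) = 1 := by
  have hm := P.measurable_privMarginal k
  induction k with
  | zero =>
    have h1 : Measurable fun u : Fin 0 → F => ∫⁻ v, P.privMarginal 0 (Fin.snoc u v) ∂P.refY :=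
      Measurable.lintegral_prod_right' (f := fun t : (Fin 0 → F) × F =>
        P.privMarginal 0 (Fin.snoc t.1 t.2)) (hm.comp (measurable_snoc 0))
    rw [refPriv, lintegral_pi_snoc _ _ hm, Measure.pi_of_empty _ (fun i => i.elim0),
      lintegral_dirac' _ h1, ← P.lintegral_initDensity,
      lintegral_prod_symm _ P.measurable_initDensity.aemeasurable]
    rfl
  | succ k ih =>
    rw [refPriv, lintegral_pi_snoc _ _ hm, ← ih (P.measurable_privMarginal k)]
    refine lintegral_congr fun y => ?_
    simp only [privMarginal_snoc]
    rw [lintegral_const_mul _ P.measurable_privDensity.of_uncurry_left, P.lintegral_privDensity,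
      mul_one]

variable (π : SamplingPolicy E) (ρ : ReconPolicy E)

/-- Decisions and reconstructions do not influence the evolution of `Y`: their kernels integrate to
one, and the state is integrated out by `lintegral_trans_mul`. The law of `Y^k` is therefore the
same for all policies. -/
lemma lintegral_law_envKernel_priv (k : ℕ) {f : (Fin (k + 1) → F) → ℝ≥0∞} (hf : Measurable f) :
    ∫⁻ h, ∫⁻ w, f (Fin.snoc (privOf h) w.2) ∂(P.envKernel k h) ∂(P.law π ρ k) =
      ∫⁻ y, P.privMarginal k y * f y ∂(P.refPriv k) := by
  induction k with
  | zero =>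
    have e : ∀ h : Fin 0 → Stage E F, ∫⁻ w, f (Fin.snoc (privOf h) w.2) ∂(P.envKernel 0 h) =
        ∫⁻ y, P.privMarginal 0 y * f y ∂(P.refPriv 0) := by
      intro h
      have h1 : Measurable fun v : F => f (Fin.snoc (privOf h) v) :=
        hf.comp (measurable_fin_snoc measurable_const measurable_id)
      have h2 : Measurable fun w : E × F =>
          P.initDensity w * f (Fin.snoc (privOf h) w.2) :=
        P.measurable_initDensity.mul (h1.comp measurable_snd)
      have h3 : Measurable fun y => P.privMarginal 0 y * f y :=
        (P.measurable_privMarginal 0).mul hf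
      have h4 : Measurable fun u : Fin 0 → F => ∫⁻ v, P.privMarginal 0 (Fin.snoc u v) *
          f (Fin.snoc u v) ∂P.refY :=
        Measurable.lintegral_prod_right' (f := fun t : (Fin 0 → F) × F =>
          P.privMarginal 0 (Fin.snoc t.1 t.2) * f (Fin.snoc t.1 t.2)) (h3.comp (measurable_snoc 0))
      have h5 : Measurable fun w : E × F => f (Fin.snoc (privOf h) w.2) := h1.comp measurable_snd
      rw [P.lintegral_envKernel_zero h h5,
        lintegral_prod_symm _ h2.aemeasurable, refPriv, lintegral_pi_snoc _ _ h3,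
        Measure.pi_of_empty _ (privOf h), lintegral_dirac' _ h4]
      refine lintegral_congr fun v => ?_
      have h6 : Measurable fun x : E => P.initDensity (x, v) :=
        P.measurable_initDensity.comp measurable_prodMk_right
      have e : P.privMarginal 0 (Fin.snoc (privOf h) v) = ∫⁻ x, P.initDensity (x, v) ∂P.refX := rfl
      rw [e]
      exact lintegral_mul_const (f (Fin.snoc (privOf h) v)) h6
    simp only [e, lintegral_const, measure_univ, mul_one]
  | succ k ih =>
    have h1 : Measurable fun h : Fin (k + 1) → Stage E F =>
        ∫⁻ w, f (Fin.snoc (privOf h) w.2) ∂(P.envKernel (k + 1) h) :=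
      measurable_lintegral_kernel (P.envKernel (k + 1)) (u := fun h => h) measurable_id
        (hf.comp (measurable_fin_snoc (measurable_privOf.comp measurable_fst) measurable_snd.snd))
    have hfy : ∀ y : Fin (k + 1) → F, Measurable fun v => f (Fin.snoc y v) := fun y =>
      hf.comp (measurable_fin_snoc measurable_const measurable_id)
    have h2 : Measurable fun t : (Fin (k + 1) → F) × F =>
        P.privDensity (t.1 (Fin.last k)) t.2 * f (Fin.snoc t.1 t.2) :=
      (P.measurable_privDensity.comp (f := fun t : (Fin (k + 1) → F) × F =>
        (t.1 (Fin.last k), t.2)) (by fun_prop)).mul (hf.comp (measurable_snoc _))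
    have h3 : Measurable fun y : Fin (k + 1) → F =>
        ∫⁻ v, P.privDensity (y (Fin.last k)) v * f (Fin.snoc y v) ∂P.refY :=
      h2.lintegral_prod_right'
    have e : ∀ (h : Fin k → Stage E F) (w : E × F) (n : Bool) (v : E),
        ∫⁻ w', f (Fin.snoc (privOf (Fin.snoc h ((w, n), v) : Fin (k + 1) → Stage E F)) w'.2)
          ∂(P.envKernel (k + 1) (Fin.snoc h ((w, n), v))) =
        ∫⁻ v, P.privDensity ((Fin.snoc (privOf h) w.2 : Fin (k + 1) → F) (Fin.last k)) v *
          f (Fin.snoc (Fin.snoc (privOf h) w.2) v) ∂P.refY := by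
      intro h w n v
      have h5 : Measurable fun w' : E × F =>
          f (Fin.snoc (privOf (Fin.snoc h ((w, n), v) : Fin (k + 1) → Stage E F)) w'.2) :=
        (hfy _).comp measurable_snd
      rw [P.lintegral_envKernel_snoc _ _ h5, privOf_snoc]
      refine (P.lintegral_trans_mul _ _ (hfy _)).trans ?_
      simp
    rw [P.lintegral_law_succ π ρ h1]
    simp only [e, lintegral_const, measure_univ, mul_one]
    have h6 : Measurable fun y => P.privMarginal (k + 1) y * f y :=
      (P.measurable_privMarginal _).mul hf
    rw [ih h3, refPriv, refPriv, lintegral_pi_snoc _ _ h6]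
    refine lintegral_congr fun y => ?_
    have h4 : Measurable fun v => P.privDensity (y (Fin.last k)) v * f (Fin.snoc y v) :=
      h2.comp measurable_prodMk_left
    rw [← lintegral_const_mul _ h4]
    refine lintegral_congr fun v => ?_
    rw [privMarginal_snoc, mul_assoc]

lemma lintegral_law_priv (k : ℕ) {f : (Fin (k + 1) → F) → ℝ≥0∞} (hf : Measurable f) :
    ∫⁻ h, f (privOf h) ∂(P.law π ρ (k + 1)) =
      ∫⁻ y, P.privMarginal k y * f y ∂(P.refPriv k) := by
  have h1 : Measurable fun h : Fin (k + 1) → Stage E F => f (privOf h) := hf.comp measurable_privOf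
  rw [P.lintegral_law_succ π ρ h1]
  simp only [privOf_snoc, lintegral_const, measure_univ, mul_one]
  exact P.lintegral_law_envKernel_priv π ρ k hf

/-- The density of `Y^k` given the shared data `Z^k`. -/
def policyPost (k : ℕ) (z : Data E (k + 1)) : (Fin (k + 1) → F) → ℝ≥0∞ :=
  P.postDensity (P.policyBelief π k (Fin.init z)) (π.collection k (Fin.init z)) (z (Fin.last k))

lemma policyPost_snoc (k : ℕ) (z : Data E k) (s : Sample E) :
    P.policyPost π k (Fin.snoc z s) =
      P.postDensity (P.policyBelief π k z) (π.collection k z) s := by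
  simp [policyPost]

lemma measurable_policyPost (k : ℕ) : Measurable (Function.uncurry (P.policyPost π k)) := by
  have h1 : Measurable fun p : Data E (k + 1) × (Fin (k + 1) → F) =>
      (Fin.init p.1 : Data E k) := measurable_fin_init.comp measurable_fst
  exact (P.measurable_postDensity (P.measurable_policyBelief π k) (π.measurableCollection k)).comp
    (f := fun p : Data E (k + 1) × (Fin (k + 1) → F) =>
      (((Fin.init p.1 : Data E k), p.2), p.1 (Fin.last k))) (by fun_prop)

/-- The joint law of the shared data and the private sequence. -/
lemma lintegral_law_data_priv (k : ℕ) {G : Data E (k + 1) → (Fin (k + 1) → F) → ℝ≥0∞}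
    (hG : Measurable (Function.uncurry G)) :
    ∫⁻ h, G (dataOf h) (privOf h) ∂(P.law π ρ (k + 1)) =
      ∫⁻ h, ∫⁻ y, P.policyPost π k (dataOf h) y * G (dataOf h) y ∂(P.refPriv k)
        ∂(P.law π ρ (k + 1)) := by
  have hk := P.isBeliefAt π ρ k
  have hb := fun z => (P.measurable_policyBelief π k).of_uncurry_left (x := z)
  have h1 : Measurable fun h : Fin (k + 1) → Stage E F => G (dataOf h) (privOf h) :=
    hG.comp (measurable_dataOf.prodMk measurable_privOf)
  have h2 : Measurable fun z => ∫⁻ y, P.policyPost π k z y * G z y ∂(P.refPriv k) :=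
    Measurable.lintegral_prod_right' (f := fun t : Data E (k + 1) × (Fin (k + 1) → F) =>
      P.policyPost π k t.1 t.2 * G t.1 t.2) ((P.measurable_policyPost π k).mul hG)
  have h3 : Measurable fun t : (((Data E k × (Fin k → E)) × BeliefPoint E F k) × Bool) × E =>
      G (Fin.snoc t.1.1.1.1 (sampleOut t.1.1.2.1 t.1.2)) t.1.1.2.2.2 := by
    have h2 : Measurable fun t : (((Data E k × (Fin k → E)) × BeliefPoint E F k) × Bool) × E =>
      sampleOut t.1.1.2.1 t.1.2 := measurable_sampleOut.comp
        (measurable_fst.fst.snd.fst.prodMk measurable_fst.snd)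
    exact hG.comp ((measurable_fin_snoc (by fun_prop) h2).prodMk (by fun_prop))
  rw [P.lintegral_law_succ π ρ h1, hk.lintegral_data h2]
  simp only [dataOf_snoc, privOf_snoc]
  refine (hk.lintegral_step (f := fun z _ q n _ =>
    G (Fin.snoc z (sampleOut q.1 n)) q.2.2) h3).trans ?_
  refine lintegral_congr_ae ?_
  filter_upwards [hk.ae_lintegral_eq_one] with h hh
  simp only [lintegral_const, measure_univ, mul_one, policyPost_snoc]
  refine (P.lintegral_outLaw_postDensity (hb _) _ (by simp [hh])
    (G := fun s y => G (Fin.snoc (dataOf h) s) y) ?_).symm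
  exact hG.comp ((measurable_fin_snoc measurable_const measurable_fst).prodMk measurable_snd)

/-- Under the joint law the private sequence has density `privMarginal`, so the zero set of that
density has joint mass zero. -/
lemma ae_policyPost_eq_zero (k : ℕ) :
    ∀ᵐ p ∂(((P.law π ρ (k + 1)).map dataOf).prod (P.refPriv k)),
      P.privMarginal k p.2 = 0 → P.policyPost π k p.1 p.2 = 0 := by
  have hpost := P.measurable_policyPost π k
  have hN : MeasurableSet {y | P.privMarginal k y = 0} :=
    measurableSet_eq_fun (P.measurable_privMarginal k) measurable_const
  have hi : Measurable ({y | P.privMarginal k y = 0}.indicator (1 : (Fin (k + 1) → F) → ℝ≥0∞)) :=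
    measurable_one.indicator hN
  have hm : Measurable fun p : Data E (k + 1) × (Fin (k + 1) → F) =>
      P.policyPost π k p.1 p.2 * {y | P.privMarginal k y = 0}.indicator 1 p.2 :=
    hpost.mul (hi.comp measurable_snd)
  have h1 : ∫⁻ p, P.policyPost π k p.1 p.2 * {y | P.privMarginal k y = 0}.indicator 1 p.2
      ∂(((P.law π ρ (k + 1)).map dataOf).prod (P.refPriv k)) = 0 := by
    have : IsProbabilityMeasure ((P.law π ρ (k + 1)).map (dataOf (E := E) (F := F))) :=
      Measure.isProbabilityMeasure_map measurable_dataOf.aemeasurable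
    rw [lintegral_prod _ hm.aemeasurable, lintegral_map hm.lintegral_prod_right' measurable_dataOf]
    refine (P.lintegral_law_data_priv π ρ k
      (G := fun _ y => {y | P.privMarginal k y = 0}.indicator 1 y)
      (hi.comp measurable_snd)).symm.trans ?_
    refine (P.lintegral_law_priv π ρ k hi).trans ?_
    exact lintegral_mul_indicator_eq_zero _
  exact ae_eq_zero_of_lintegral_mul_indicator hpost
    ((P.measurable_privMarginal k).comp measurable_snd) h1

/-- The mutual information of `Z^k` and `Y^k`, in terms of densities. -/
def dataInfo (k : ℕ) : ℝ≥0∞ :=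
  ∫⁻ h, ∫⁻ y, klInt (P.policyPost π k (dataOf h) y) (P.privMarginal k y) ∂(P.refPriv k)
    ∂(P.law π ρ (k + 1))

/-- Relative to the law of `Z^k` times `refPriv`, the joint law has density `policyPost` and the
product of the marginals has density `privMarginal`. The formula for the divergence of two densities
applies. -/
lemma mutualInfo_eq_dataInfo (k : ℕ) :
    mutualInfo ((P.law π ρ (k + 1)).map fun h => (dataOf h, privOf h)) = P.dataInfo π ρ k := by
  have : IsProbabilityMeasure ((P.law π ρ (k + 1)).map (dataOf (E := E) (F := F))) :=
    Measure.isProbabilityMeasure_map measurable_dataOf.aemeasurable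
  have hpost := P.measurable_policyPost π k
  have hpost' : Measurable fun p : Data E (k + 1) × (Fin (k + 1) → F) =>
    P.policyPost π k p.1 p.2 := hpost
  have hn := P.measurable_privMarginal k
  have hns : Measurable fun p : Data E (k + 1) × (Fin (k + 1) → F) => P.privMarginal k p.2 :=
    hn.comp measurable_snd
  have hdp : Measurable fun h : Fin (k + 1) → Stage E F => (dataOf h, privOf h) :=
    measurable_dataOf.prodMk measurable_privOf
  have e1 : (P.law π ρ (k + 1)).map (fun h => (dataOf h, privOf h)) =
      (((P.law π ρ (k + 1)).map dataOf).prod (P.refPriv k)).withDensity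
        fun p => P.policyPost π k p.1 p.2 := by
    refine Measure.ext_of_lintegral _ fun G hG => ?_
    rw [lintegral_map hG hdp, lintegral_withDensity_eq_lintegral_mul _ hpost' hG,
      lintegral_prod _ (hpost'.mul hG).aemeasurable,
      lintegral_map (hpost'.mul hG).lintegral_prod_right' measurable_dataOf]
    exact P.lintegral_law_data_priv π ρ k (G := fun z y => G (z, y)) hG
  have e2 : ((P.law π ρ (k + 1)).map fun h => (dataOf h, privOf h)).fst =
      (P.law π ρ (k + 1)).map dataOf := Measure.fst_map_prodMk measurable_privOf
  have e3 : ((P.law π ρ (k + 1)).map fun h => (dataOf h, privOf h)).snd =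
      (P.refPriv k).withDensity (P.privMarginal k) := by
    rw [Measure.snd_map_prodMk measurable_dataOf]
    refine Measure.ext_of_lintegral _ fun f hf => ?_
    rw [lintegral_map hf measurable_privOf, lintegral_withDensity_eq_lintegral_mul _ hn hf]
    exact P.lintegral_law_priv π ρ k hf
  have hfin : ∫⁻ p, P.policyPost π k p.1 p.2
      ∂(((P.law π ρ (k + 1)).map dataOf).prod (P.refPriv k)) ≠ ∞ := by
    have h1 : IsProbabilityMeasure ((P.law π ρ (k + 1)).map fun h => (dataOf h, privOf h)) :=
      Measure.isProbabilityMeasure_map hdp.aemeasurable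
    rw [e1] at h1
    have h2 := h1.measure_univ
    rw [withDensity_apply _ MeasurableSet.univ, Measure.restrict_univ] at h2
    simp [h2]
  rw [mutualInfo, e2, e3, e1, prod_withDensity_right hn, klDiv_withDensity _ hpost'
    hns hfin ?_ (P.ae_policyPost_eq_zero π ρ k)]
  · have hk : Measurable fun p : Data E (k + 1) × (Fin (k + 1) → F) =>
      klInt (P.policyPost π k p.1 p.2) (P.privMarginal k p.2) :=
      measurable_klInt hpost' (hn.comp measurable_snd)
    rw [lintegral_prod _ hk.aemeasurable, lintegral_map hk.lintegral_prod_right' measurable_dataOf]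
    rfl
  · have := lintegral_prod (μ := (P.law π ρ (k + 1)).map dataOf) (ν := P.refPriv k) _
      (hn.comp measurable_snd).aemeasurable
    simp only [Function.comp_apply, lintegral_privMarginal, lintegral_const, measure_univ,
      mul_one] at this
    simp [this]

/-! ## The chain rule for the mutual information -/

section MeasurableOutLaw

variable {k : ℕ} {Θ : Type*} [MeasurableSpace Θ] {b : Θ → Belief E F k} {a : Θ → Collection E k}

lemma measurable_lintegral_outLaw (hb : Measurable (Function.uncurry b))
    (ha : MeasurableCollection a) {G : Θ → Sample E → ℝ≥0∞}
    (hG : Measurable (Function.uncurry G)) :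
    Measurable fun t => ∫⁻ z, G t z ∂(P.outLaw (b t) (a t)) := by
  have hbt : ∀ t, Measurable (b t) := fun t => hb.of_uncurry_left
  have hGt : ∀ t, Measurable (G t) := fun t => hG.of_uncurry_left
  have e : ∀ t, ∫⁻ z, G t z ∂(P.outLaw (b t) (a t)) =
      ∫⁻ z, P.outDensity (b t) (a t) z * G t z ∂P.refSample := fun t => by
    rw [outLaw, lintegral_withDensity_eq_lintegral_mul _
      (P.measurable_outDensity_apply (hbt t) _) (hGt t)]
    rfl
  simp_rw [e]
  exact Measurable.lintegral_prod_right' (f := fun p : Θ × Sample E =>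
    P.outDensity (b p.1) (a p.1) p.2 * G p.1 p.2) ((P.measurable_outDensity hb ha).mul hG)

lemma measurable_infoDensity (hb : Measurable (Function.uncurry b))
    (ha : MeasurableCollection a) : Measurable fun t => P.infoDensity (b t) (a t) := by
  refine P.measurable_lintegral_outLaw hb ha ?_
  refine Measurable.lintegral_prod_right' (f := fun p : (Θ × Sample E) × (Fin (k + 1) → F) =>
    klInt (P.postDensity (b p.1.1) (a p.1.1) p.1.2 p.2) (P.priorDensity (b p.1.1) p.2)) ?_
  refine measurable_klInt ?_ ?_
  · exact (P.measurable_postDensity hb ha).comp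
      (f := fun p : (Θ × Sample E) × (Fin (k + 1) → F) => ((p.1.1, p.2), p.1.2)) (by fun_prop)
  · exact (P.measurable_priorDensity hb).comp
      (f := fun p : (Θ × Sample E) × (Fin (k + 1) → F) => (p.1.1, p.2)) (by fun_prop)

end MeasurableOutLaw

/-- The divergence of the posterior of `Y^k` given `Z_k` from a reference law splits into the
information loss and the divergence of the prior. -/
lemma lintegral_outLaw_klInt {k : ℕ} {b : Belief E F k} (hb : Measurable b) (a : Collection E k)
    (h1 : ∫⁻ q, b q ∂(P.refBelief k) = 1) {n : (Fin (k + 1) → F) → ℝ≥0∞} (hn : Measurable n)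
    (hnt : ∀ᵐ y ∂(P.refPriv k), n y ≠ ∞)
    (hn0 : ∀ᵐ y ∂(P.refPriv k), n y = 0 → P.priorDensity b y = 0) :
    ∫⁻ z, ∫⁻ y, klInt (P.postDensity b a z y) (n y) ∂(P.refPriv k) ∂(P.outLaw b a) =
      P.infoDensity b a + ∫⁻ y, klInt (P.priorDensity b y) (n y) ∂(P.refPriv k) := by
  have : IsProbabilityMeasure (P.outLaw b a) := P.isProbabilityMeasure_outLaw hb a h1
  have hfin : ∫⁻ q, b q ∂(P.refBelief k) ≠ ∞ := by simp [h1]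
  have hpost := P.measurable_postDensity_apply hb a
  have hprior := P.measurable_priorDensity_apply hb
  have hpt : ∀ᵐ y ∂(P.refPriv k), P.priorDensity b y < ∞ :=
    ae_lt_top hprior (by rw [P.lintegral_priorDensity hb]; exact hfin)
  have m1 : Measurable fun p : Sample E × (Fin (k + 1) → F) =>
      klInt (P.postDensity b a p.1 p.2) (n p.2) :=
    measurable_klInt (hpost.comp measurable_swap) (hn.comp measurable_snd)
  have m2 : Measurable fun p : Sample E × (Fin (k + 1) → F) =>
      klInt (P.postDensity b a p.1 p.2) (P.priorDensity b p.2) :=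
    measurable_klInt (hpost.comp measurable_swap) (hprior.comp measurable_snd)
  -- With `y` outermost, the mixture identity holds for almost every fixed `y`, the mixture being
  -- taken over the law of `Z_k`.
  rw [infoDensity, lintegral_lintegral_swap (f := fun z y => klInt (P.postDensity b a z y) (n y))
      m1.aemeasurable,
    lintegral_lintegral_swap (f := fun z y => klInt (P.postDensity b a z y) (P.priorDensity b y))
      m2.aemeasurable, ← lintegral_add_left (Measurable.lintegral_prod_left' m2)]
  refine lintegral_congr_ae ?_
  filter_upwards [P.ae_lintegral_outLaw_postDensity hb a hfin, hnt, hn0, hpt] with y hy h2 h3 h4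
  exact lintegral_klInt_eq_add _ (P.measurable_postDensity_left hb a y) hy h4.ne h2 h3

lemma ae_privMarginal_ne_top (k : ℕ) : ∀ᵐ y ∂(P.refPriv k), P.privMarginal k y ≠ ∞ :=
  (ae_lt_top (P.measurable_privMarginal k) (by simp [lintegral_privMarginal])).mono
    fun _ h => h.ne

/-- The zero set of `privMarginal` is tested again, now with the belief before `Z_k` is drawn; the
expectation of its nonnegative conditional mass is zero. -/
lemma ae_priorDensity_eq_zero (k : ℕ) : ∀ᵐ h ∂(P.law π ρ k), ∀ᵐ y ∂(P.refPriv k),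
    P.privMarginal k y = 0 → P.priorDensity (P.policyBelief π k (dataOf h)) y = 0 := by
  have hb := fun z => (P.measurable_policyBelief π k).of_uncurry_left (x := z)
  have hN : MeasurableSet {y | P.privMarginal k y = 0} :=
    measurableSet_eq_fun (P.measurable_privMarginal k) measurable_const
  have hi : Measurable ({y | P.privMarginal k y = 0}.indicator (1 : (Fin (k + 1) → F) → ℝ≥0∞)) :=
    measurable_one.indicator hN
  have h1 := P.isBeliefAt π ρ k (fun _ _ q => {y | P.privMarginal k y = 0}.indicator 1 q.2.2)
    (hi.comp measurable_snd.snd.snd)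
  rw [P.lintegral_law_envKernel_priv π ρ k hi, lintegral_mul_indicator_eq_zero] at h1
  have hm : Measurable fun z : Data E k => ∫⁻ q, P.policyBelief π k z q *
      {y | P.privMarginal k y = 0}.indicator 1 q.2.2 ∂(P.refBelief k) :=
    Measurable.lintegral_prod_right' (f := fun t : Data E k × BeliefPoint E F k =>
      P.policyBelief π k t.1 t.2 * {y | P.privMarginal k y = 0}.indicator 1 t.2.2.2)
      ((P.measurable_policyBelief π k).mul (hi.comp measurable_snd.snd.snd))
  have h2 := (lintegral_eq_zero_iff (hm.comp measurable_dataOf)).1 h1.symm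
  filter_upwards [h2] with h hh
  have hbi : Measurable fun q => P.policyBelief π k (dataOf h) q *
      {y | P.privMarginal k y = 0}.indicator 1 q.2.2 := (hb _).mul (hi.comp measurable_snd.snd)
  have h3 : ∫⁻ y, P.priorDensity (P.policyBelief π k (dataOf h)) y *
      {y | P.privMarginal k y = 0}.indicator 1 y ∂(P.refPriv k) = 0 := by
    refine Eq.trans ?_ hh
    refine Eq.trans ?_ (P.lintegral_refBelief_priv hbi).symm
    refine lintegral_congr fun y => ?_
    exact (lintegral_mul_const _ ((hb _).comp (by fun_prop))).symm
  exact ae_eq_zero_of_lintegral_mul_indicator (P.measurable_priorDensity_apply (hb _))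
    (P.measurable_privMarginal k) h3

/-- The divergence of the law of `Y^k` given `Z^{k-1}` from the law of `Y^k`. -/
def priorInfo (k : ℕ) : ℝ≥0∞ :=
  ∫⁻ h, ∫⁻ y, klInt (P.priorDensity (P.policyBelief π k (dataOf h)) y) (P.privMarginal k y)
    ∂(P.refPriv k) ∂(P.law π ρ k)

/-- The split `lintegral_outLaw_klInt`, averaged over the past data. The term `priorInfo` plays the
role of `I(Z^{k-1};Y^k)`. -/
lemma dataInfo_eq (k : ℕ) :
    P.dataInfo π ρ k =
      ∫⁻ h, P.infoDensity (P.policyBelief π k (dataOf h)) (π.collection k (dataOf h))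
        ∂(P.law π ρ k) + P.priorInfo π ρ k := by
  have hb := P.measurable_policyBelief π k
  have hk := P.isBeliefAt π ρ k
  have hm : Measurable fun z : Data E (k + 1) => ∫⁻ y, klInt (P.policyPost π k z y)
      (P.privMarginal k y) ∂(P.refPriv k) :=
    Measurable.lintegral_prod_right' (f := fun t : Data E (k + 1) × (Fin (k + 1) → F) =>
      klInt (P.policyPost π k t.1 t.2) (P.privMarginal k t.2))
      (measurable_klInt (P.measurable_policyPost π k)
        ((P.measurable_privMarginal k).comp measurable_snd))
  have hi : Measurable fun z => P.infoDensity (P.policyBelief π k z) (π.collection k z) :=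
    P.measurable_infoDensity hb (π.measurableCollection k)
  have hih : Measurable fun h : Fin k → Stage E F =>
    P.infoDensity (P.policyBelief π k (dataOf h)) (π.collection k (dataOf h)) :=
    hi.comp measurable_dataOf
  rw [dataInfo, hk.lintegral_data hm, priorInfo, ← lintegral_add_left hih]
  refine lintegral_congr_ae ?_
  filter_upwards [hk.ae_lintegral_eq_one, P.ae_priorDensity_eq_zero π ρ k] with h h1 h2
  simp only [policyPost_snoc]
  exact P.lintegral_outLaw_klInt hb.of_uncurry_left _ h1 (P.measurable_privMarginal k)
    (P.ae_privMarginal_ne_top k) h2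

/-- Before any sample the prior of `Y_0` is its law, and the divergence of a finite density from
itself vanishes. -/
lemma priorInfo_zero : P.priorInfo π ρ 0 = 0 := by
  have e : ∀ (h : Fin 0 → Stage E F) (y : Fin 1 → F),
      P.priorDensity (P.policyBelief π 0 (dataOf h)) y = P.privMarginal 0 y := by
    intro h y
    have hm : Measurable fun r : E × Memory E 0 =>
        P.policyBelief π 0 (dataOf h) (r.1, r.2, y) :=
      P.measurable_initDensity.comp (by fun_prop)
    rw [priorDensity, lintegral_prod _ hm.aemeasurable]
    refine lintegral_congr fun x => ?_
    rw [refMemory, Measure.pi_of_empty _ (memoryOf h)]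
    exact lintegral_dirac' _ (hm.comp (measurable_prodMk_left (x := x)))
  rw [priorInfo]
  refine (lintegral_congr fun h => ?_).trans lintegral_zero
  refine (lintegral_congr_ae ?_).trans lintegral_zero
  filter_upwards [P.ae_privMarginal_ne_top 0] with y hy
  rw [e, klInt_self hy]

/-- Given `Y^k`, the data `Z^k` say nothing more about `Y_{k+1}`. Both densities acquire the same
factor `p(y_{k+1} | y_k)`, which leaves the divergence by homogeneity and integrates to one. -/
lemma priorInfo_succ (k : ℕ) : P.priorInfo π ρ (k + 1) = P.dataInfo π ρ k := by
  have hb := P.measurable_policyBelief π k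
  refine lintegral_congr fun h => ?_
  have hm : Measurable fun y => klInt (P.priorDensity (P.policyBelief π (k + 1) (dataOf h)) y)
      (P.privMarginal (k + 1) y) :=
    measurable_klInt (P.measurable_priorDensity_apply
      (P.measurable_policyBelief π (k + 1)).of_uncurry_left) (P.measurable_privMarginal _)
  rw [refPriv, lintegral_pi_snoc _ _ hm]
  refine lintegral_congr fun y => ?_
  have e : ∀ v, P.priorDensity (P.policyBelief π (k + 1) (dataOf h)) (Fin.snoc y v) =
      P.policyPost π k (dataOf h) y * P.privDensity (y (Fin.last k)) v := fun v =>
    P.priorDensity_update hb.of_uncurry_left _ _ y v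
  have hp : Measurable (P.privDensity (y (Fin.last k))) := P.measurable_privDensity.of_uncurry_left
  have hpt : ∀ᵐ v ∂P.refY, P.privDensity (y (Fin.last k)) v < ∞ :=
    ae_lt_top hp (by simp [P.lintegral_privDensity])
  rw [lintegral_congr_ae (g := fun v => klInt (P.policyPost π k (dataOf h) y)
    (P.privMarginal k y) * P.privDensity (y (Fin.last k)) v), lintegral_const_mul _ hp,
    P.lintegral_privDensity, mul_one]
  filter_upwards [hpt] with v hv
  rw [e, privMarginal_snoc, klInt_mul_right hv.ne]

/-- The mutual information is the sum of the expected information losses. -/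
lemma dataInfo_eq_sum (k : ℕ) :
    P.dataInfo π ρ k = ∑ j ∈ Finset.range (k + 1),
      ∫⁻ h, P.infoDensity (P.policyBelief π j (dataOf h)) (π.collection j (dataOf h))
        ∂(P.law π ρ j) := by
  induction k with
  | zero => simp [dataInfo_eq, priorInfo_zero]
  | succ k ih => rw [dataInfo_eq, priorInfo_succ, Finset.sum_range_succ _ (k + 1), ih, add_comm]

end Model

namespace Model

variable (P : Model E F) (π : SamplingPolicy E) (ρ : ReconPolicy E)

/-! ## The cost-to-go of a pair of policies -/

/-- The expected distortion at time `k`, given the shared data and the reconstructions. -/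
def stageDistortion (k : ℕ) (z : Data E k) (r : Fin k → E) : ℝ≥0∞ :=
  ∫⁻ q, P.policyBelief π k z q * ∫⁻ n, ∫⁻ v, (P.distortion q.1 v : ℝ≥0∞)
    ∂(ρ.kernel k (Fin.snoc z (sampleOut q.1 n), r))
    ∂((π.collection k z).kernel (q.1, q.2.1)) ∂(P.refBelief k)

/-- The cost-to-go of a pair of policies when `t` decisions remain. -/
def policyCost : ∀ (_t k : ℕ), Data E k → (Fin k → E) → ℝ≥0∞
  | 0, _, _, _ => 0
  | t + 1, k, z, r => P.stageDistortion π ρ k z r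
      + P.weight * P.infoDensity (P.policyBelief π k z) (π.collection k z)
      + ∫⁻ s, ∫⁻ v, policyCost t (k + 1) (Fin.snoc z s) (Fin.snoc r v)
          ∂(ρ.kernel k (Fin.snoc z s, r)) ∂(P.outLaw (P.policyBelief π k z) (π.collection k z))

lemma measurable_distortion_coe : Measurable fun p : E × E => (P.distortion p.1 p.2 : ℝ≥0∞) :=
  P.measurable_distortion.coe_nnreal_ennreal

lemma measurable_stageDistortion (k : ℕ) :
    Measurable (Function.uncurry (P.stageDistortion π ρ k)) := by
  have h1 : Measurable fun t : ((Data E k × (Fin k → E)) × BeliefPoint E F k) × Bool =>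
      sampleOut t.1.2.1 t.2 :=
    measurable_sampleOut.comp (measurable_fst.snd.fst.prodMk measurable_snd)
  have h2 : Measurable fun t : ((Data E k × (Fin k → E)) × BeliefPoint E F k) × Bool =>
      ∫⁻ v, (P.distortion t.1.2.1 v : ℝ≥0∞)
        ∂(ρ.kernel k (Fin.snoc t.1.1.1 (sampleOut t.1.2.1 t.2), t.1.1.2)) :=
    measurable_lintegral_kernel (ρ.kernel k) (u := fun
      t : ((Data E k × (Fin k → E)) × BeliefPoint E F k) × Bool =>
      ((Fin.snoc t.1.1.1 (sampleOut t.1.2.1 t.2) : Data E (k + 1)), t.1.1.2))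
      ((measurable_fin_snoc (by fun_prop) h1).prodMk (by fun_prop))
      (P.measurable_distortion_coe.comp (measurable_fst.fst.snd.fst.prodMk measurable_snd))
  have h3 := measurable_lintegral_kernel (π.kernel k) (u := fun
      t : (Data E k × (Fin k → E)) × BeliefPoint E F k => (t.1.1, t.2.1, t.2.2.1))
      (by fun_prop) (f := fun (p : (Data E k × (Fin k → E)) × BeliefPoint E F k) n =>
        ∫⁻ v, (P.distortion p.2.1 v : ℝ≥0∞)
          ∂(ρ.kernel k (Fin.snoc p.1.1 (sampleOut p.2.1 n), p.1.2))) h2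
  exact Measurable.lintegral_prod_right' (f := fun
    t : (Data E k × (Fin k → E)) × BeliefPoint E F k => P.policyBelief π k t.1.1 t.2 *
      ∫⁻ n, ∫⁻ v, (P.distortion t.2.1 v : ℝ≥0∞)
        ∂(ρ.kernel k (Fin.snoc t.1.1 (sampleOut t.2.1 n), t.1.2))
        ∂((π.collection k t.1.1).kernel (t.2.1, t.2.2.1)))
    ((measurable_apply_apply (P.measurable_policyBelief π k) measurable_fst.fst
      measurable_snd).mul h3)

lemma measurable_infoDensity_policy (k : ℕ) : Measurable fun z =>
    P.infoDensity (P.policyBelief π k z) (π.collection k z) :=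
  P.measurable_infoDensity (P.measurable_policyBelief π k) (π.measurableCollection k)

lemma measurable_policyCost (t k : ℕ) : Measurable (Function.uncurry (P.policyCost π ρ t k)) := by
  induction t generalizing k with
  | zero => exact measurable_const
  | succ t ih =>
    have h1 : Measurable fun p : (Data E k × (Fin k → E)) × Sample E =>
        ∫⁻ v, P.policyCost π ρ t (k + 1) (Fin.snoc p.1.1 p.2) (Fin.snoc p.1.2 v)
          ∂(ρ.kernel k (Fin.snoc p.1.1 p.2, p.1.2)) :=
      measurable_lintegral_kernel (ρ.kernel k) (u := fun
        p : (Data E k × (Fin k → E)) × Sample E =>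
        ((Fin.snoc p.1.1 p.2 : Data E (k + 1)), p.1.2))
        ((measurable_fin_snoc (by fun_prop) (by fun_prop)).prodMk (by fun_prop))
        ((ih (k + 1)).comp ((measurable_fin_snoc (by fun_prop) (by fun_prop)).prodMk
          (measurable_fin_snoc (by fun_prop) (by fun_prop))))
    have h2 := P.measurable_lintegral_outLaw
      (b := fun p : Data E k × (Fin k → E) => P.policyBelief π k p.1)
      (a := fun p : Data E k × (Fin k → E) => π.collection k p.1)
      (measurable_apply_apply (P.measurable_policyBelief π k) measurable_fst.fst measurable_snd)
      (fun n => (π.measurableCollection k).comp n measurable_fst.fst measurable_snd.fst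
        measurable_snd.snd)
      (G := fun p s => ∫⁻ v, P.policyCost π ρ t (k + 1) (Fin.snoc p.1 s) (Fin.snoc p.2 v)
        ∂(ρ.kernel k (Fin.snoc p.1 s, p.2))) h1
    exact ((P.measurable_stageDistortion π ρ k).add
      (((P.measurable_infoDensity_policy π k).comp measurable_fst).const_mul _)).add h2

lemma lintegral_policyCost_succ (t k : ℕ) :
    ∫⁻ h, P.policyCost π ρ (t + 1) k (dataOf h) (reconOf h) ∂(P.law π ρ k) =
      (∫⁻ h, P.stageDistortion π ρ k (dataOf h) (reconOf h) ∂(P.law π ρ k)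
        + P.weight * ∫⁻ h, P.infoDensity (P.policyBelief π k (dataOf h))
            (π.collection k (dataOf h)) ∂(P.law π ρ k))
      + ∫⁻ h, P.policyCost π ρ t (k + 1) (dataOf h) (reconOf h) ∂(P.law π ρ (k + 1)) := by
  have h1 : Measurable fun h : Fin k → Stage E F =>
      P.stageDistortion π ρ k (dataOf h) (reconOf h) :=
    (P.measurable_stageDistortion π ρ k).comp (measurable_dataOf.prodMk measurable_reconOf)
  have h2 : Measurable fun h : Fin k → Stage E F =>
      P.infoDensity (P.policyBelief π k (dataOf h)) (π.collection k (dataOf h)) :=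
    (P.measurable_infoDensity_policy π k).comp measurable_dataOf
  have h12 : Measurable fun h : Fin k → Stage E F =>
      P.stageDistortion π ρ k (dataOf h) (reconOf h) +
        P.weight * P.infoDensity (P.policyBelief π k (dataOf h)) (π.collection k (dataOf h)) :=
    h1.add (h2.const_mul _)
  rw [(P.isBeliefAt π ρ k).lintegral_data_recon (P.measurable_policyCost π ρ t (k + 1)),
    ← lintegral_const_mul _ h2, ← lintegral_add_left h1,
    ← lintegral_add_left h12]
  rfl

lemma lintegral_policyCost (t k : ℕ) :
    ∫⁻ h, P.policyCost π ρ t k (dataOf h) (reconOf h) ∂(P.law π ρ k) =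
      ∑ j ∈ Finset.range t,
        (∫⁻ h, P.stageDistortion π ρ (k + j) (dataOf h) (reconOf h) ∂(P.law π ρ (k + j))
        + P.weight * ∫⁻ h, P.infoDensity (P.policyBelief π (k + j) (dataOf h))
            (π.collection (k + j) (dataOf h)) ∂(P.law π ρ (k + j))) := by
  induction t generalizing k with
  | zero => simp [policyCost]
  | succ t ih =>
    rw [lintegral_policyCost_succ, ih (k + 1), Finset.sum_range_succ', add_comm]
    congr 1
    refine Finset.sum_congr rfl fun j _ => ?_
    rw [show k + 1 + j = k + (j + 1) by omega]

/-- The last term is conditioned on the data and reconstructions through the belief; in the earlier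
terms the last stage integrates to one. -/
lemma lintegral_sum_distortion (n : ℕ) :
    ∫⁻ h, ∑ k : Fin n, (P.distortion (h k).1.1.1 (h k).2 : ℝ≥0∞) ∂(P.law π ρ n) =
      ∑ j ∈ Finset.range n,
        ∫⁻ h, P.stageDistortion π ρ j (dataOf h) (reconOf h) ∂(P.law π ρ j) := by
  have hd : ∀ (n : ℕ) (k : Fin n), Measurable fun h : Fin n → Stage E F =>
      (P.distortion (h k).1.1.1 (h k).2 : ℝ≥0∞) := fun n k =>
    P.measurable_distortion_coe.comp (f := fun h : Fin n → Stage E F => ((h k).1.1.1, (h k).2))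
      (by fun_prop)
  induction n with
  | zero => simp
  | succ n ih =>
    have hl : ∫⁻ h, (P.distortion (h (Fin.last n)).1.1.1 (h (Fin.last n)).2 : ℝ≥0∞)
        ∂(P.law π ρ (n + 1)) =
        ∫⁻ h, P.stageDistortion π ρ n (dataOf h) (reconOf h) ∂(P.law π ρ n) := by
      rw [P.lintegral_law_succ π ρ (hd (n + 1) (Fin.last n))]
      simp only [Fin.snoc_last]
      exact (P.isBeliefAt π ρ n).lintegral_step (f := fun _ _ q _ v => (P.distortion q.1 v : ℝ≥0∞))
        (P.measurable_distortion_coe.comp (measurable_fst.fst.snd.fst.prodMk measurable_snd))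
    have hi : Measurable fun h : Fin (n + 1) → Stage E F => ∑ k : Fin n,
        (P.distortion (h k.castSucc).1.1.1 (h k.castSucc).2 : ℝ≥0∞) :=
      Finset.measurable_sum _ fun k _ => hd (n + 1) k.castSucc
    simp_rw [Fin.sum_univ_castSucc]
    rw [lintegral_add_left hi, hl, Finset.sum_range_succ, ← ih, P.lintegral_law_succ π ρ hi]
    simp only [Fin.snoc_castSucc, lintegral_const, measure_univ, mul_one]

lemma objective_eq :
    P.objective π ρ =
      ∫⁻ h, P.policyCost π ρ (P.horizon + 1) 0 (dataOf h) (reconOf h) ∂(P.law π ρ 0) := by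
  have hd : ∀ k : Fin (P.horizon + 1), Measurable fun h : Fin (P.horizon + 1) → Stage E F =>
      (P.distortion (h k).1.1.1 (h k).2 : ℝ≥0∞) := fun k =>
    P.measurable_distortion_coe.comp
      (f := fun h : Fin (P.horizon + 1) → Stage E F => ((h k).1.1.1, (h k).2)) (by fun_prop)
  rw [objective, ← lintegral_finsetSum _ fun k _ => hd k, lintegral_sum_distortion,
    mutualInfo_eq_dataInfo, dataInfo_eq_sum, lintegral_policyCost, Finset.mul_sum,
    ← Finset.sum_add_distrib]
  refine Finset.sum_congr rfl fun j _ => ?_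
  rw [zero_add j]

/-! ## The Bellman equation and the cost of a policy -/

section Bellman

variable {π ρ} {k : ℕ} {z : Data E k}

lemma isBelief_policyBelief (h1 : ∫⁻ q, P.policyBelief π k z q ∂(P.refBelief k) = 1) :
    P.IsBelief (P.policyBelief π k z) :=
  ⟨(P.measurable_policyBelief π k).of_uncurry_left, h1, {i | (z i).isLeft = false},
    fun _ hq i => P.policyBelief_ne_zero π hq i⟩

lemma ae_outLaw_policyBelief (h1 : ∫⁻ q, P.policyBelief π k z q ∂(P.refBelief k) = 1) :
    ∀ᵐ s ∂(P.outLaw (P.policyBelief π k z) (π.collection k z)),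
      ∫⁻ q, P.policyBelief π (k + 1) (Fin.snoc z s) q ∂(P.refBelief (k + 1)) = 1 := by
  have hb : Measurable (P.policyBelief π k z) := (P.measurable_policyBelief π k).of_uncurry_left
  filter_upwards [P.ae_outLaw_outDensity hb (π.collection k z) (by simp [h1])] with s hs
  rw [policyBelief_snoc]
  exact P.lintegral_update_eq_one hb _ hs.1 hs.2

/-- After a blank the reconstruction kernel is the same for every hidden state, so Tonelli makes its
contribution an average of `distLoss` over the reconstructed value. After a retained sample the
kernel may use the state. -/
lemma stageDistortion_eq (r : Fin k → E) :
    P.stageDistortion π ρ k z r =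
      (∫⁻ x, ∫⁻ u, ((π.collection k z).prob true x u.1 * P.policyBelief π k z (x, u)) *
          ∫⁻ v, (P.distortion x v : ℝ≥0∞) ∂(ρ.kernel k (Fin.snoc z (Sum.inl x), r))
        ∂((P.refMemory k).prod (P.refPriv k)) ∂P.refX) +
      ∫⁻ v, P.distLoss (P.policyBelief π k z) (π.collection k z) v
        ∂(ρ.kernel k (Fin.snoc z (Sum.inr ()), r)) := by
  have hb : Measurable (P.policyBelief π k z) := (P.measurable_policyBelief π k).of_uncurry_left
  have hG : ∀ n, Measurable fun q : BeliefPoint E F k => ∫⁻ v, (P.distortion q.1 v : ℝ≥0∞)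
      ∂(ρ.kernel k (Fin.snoc z (sampleOut q.1 n), r)) := fun n =>
    measurable_lintegral_kernel (ρ.kernel k) (u := fun q : BeliefPoint E F k =>
      ((Fin.snoc z (sampleOut q.1 n) : Data E (k + 1)), r))
      ((measurable_fin_snoc measurable_const (measurable_sampleOut.comp
        (f := fun q : BeliefPoint E F k => (q.1, n)) (by fun_prop))).prodMk measurable_const)
      (P.measurable_distortion_coe.comp (measurable_fst.fst.prodMk measurable_snd))
  rw [stageDistortion, P.lintegral_belief_decision hb _ hG]
  congr 1
  refine (lintegral_lintegral_mul_swap (ν := P.refBelief k)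
    (μ := ρ.kernel k (Fin.snoc z (Sum.inr ()), r)) (measurable_prob_mul hb _ false)
    (f := fun (v : E) (q : BeliefPoint E F k) => (P.distortion q.1 v : ℝ≥0∞))
    (P.measurable_distortion_coe.comp (measurable_snd.fst.prodMk measurable_fst))).symm.trans ?_
  refine lintegral_congr fun v => lintegral_congr fun q => ?_
  exact mul_comm _ _

/-- The collection that `π` uses at `z` is one competitor in the Bellman infimum, and its updated
belief is the next belief of `π`, to which the induction hypothesis applies almost surely. -/
lemma costToGo_le_policyCost (t : ℕ) (r : Fin k → E)
    (h1 : ∫⁻ q, P.policyBelief π k z q ∂(P.refBelief k) = 1) :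
    P.costToGo t k (P.policyBelief π k z) ≤ P.policyCost π ρ t k z r := by
  induction t generalizing k with
  | zero => simp [costToGo]
  | succ t ih =>
    refine (iInf_le _ (π.collection k z)).trans (add_le_add (add_le_add ?_ ?_) ?_)
    · rw [P.stageDistortion_eq]
      -- The distortion of retained states is dropped, and an average of `distLoss` is at least its
      -- infimum.
      refine le_add_left ?_
      refine le_trans ?_ (lintegral_mono fun v => iInf_le _ v)
      simp
    · rw [P.infoLoss_eq (P.isBelief_policyBelief h1)]
    -- Only monotonicity of the integral is used, because `costToGo` is an infimum over all
    -- collections and is not known to be measurable.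
    · refine lintegral_mono_ae ?_
      filter_upwards [P.ae_outLaw_policyBelief h1] with s hs
      rw [policyBelief_snoc] at hs
      have h2 : ∀ v : E, P.costToGo t (k + 1) (P.update (P.policyBelief π k z)
          (π.collection k z) s) ≤ P.policyCost π ρ t (k + 1) (Fin.snoc z s) (Fin.snoc r v) := by
        intro v
        have := ih (z := Fin.snoc z s) (Fin.snoc r v) (by rw [policyBelief_snoc]; exact hs)
        rwa [policyBelief_snoc] at this
      refine le_trans ?_ (lintegral_mono h2)
      simp

end Bellman

/-! ### Attainment by the two-step policy. -/

section TwoStep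

variable {P} {S : ∀ k, Belief E F k → Collection E k} (hmeas : P.IsMeasurableSelection S)

lemma collection_twoStepPolicy (k : ℕ) (z : Data E k) :
    (P.twoStepPolicy S hmeas).collection k z = S k (P.beliefOf S k z) := by
  have h : ((P.twoStepPolicy S hmeas).collection k z).kernel =
      (S k (P.beliefOf S k z)).kernel := by
    ext
    rfl
  -- A collection is its kernel together with a proof, so equality of kernels is enough once both
  -- sides are variables.
  generalize (P.twoStepPolicy S hmeas).collection k z = a at h
  generalize S k (P.beliefOf S k z) = a' at h
  cases a
  cases a'
  cases h
  rfl

lemma policyBelief_twoStepPolicy (k : ℕ) (z : Data E k) :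
    P.policyBelief (P.twoStepPolicy S hmeas) k z = P.beliefOf S k z := by
  induction k with
  | zero => rfl
  | succ k ih => rw [policyBelief, collection_twoStepPolicy, ih, beliefOf]

/-- Each inequality of `costToGo_le_policyCost` is now reversed: retained states cost nothing since
`l_D(x, x) = 0`, the value chosen at a blank minimizes `distLoss`, and `S` attains the Bellman
infimum. The relation `t + k = P.horizon + 1` identifies `costToGo` with `value`, for which the
minimality of `S` is assumed. -/
lemma policyCost_twoStepPolicy_le (hS : P.IsBellmanSolution S)
    {g : ∀ k : ℕ, Data E (k + 1) → E} (hg : ∀ k, Measurable (g k)) (hopt : P.IsOptimalRecon S g)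
    {t k : ℕ} (htk : t + k = P.horizon + 1) {z : Data E k} (r : Fin k → E)
    (h1 : ∫⁻ q, P.beliefOf S k z q ∂(P.refBelief k) = 1) :
    P.policyCost (P.twoStepPolicy S hmeas) (ReconPolicy.ofFun g hg) t k z r ≤
      P.costToGo t k (P.beliefOf S k z) := by
  induction t generalizing k with
  | zero => simp [policyCost]
  | succ t ih =>
    have hk : k ≤ P.horizon := by omega
    have ht : P.horizon + 1 - (k + 1) = t := by omega
    have hb' := h1
    rw [← policyBelief_twoStepPolicy hmeas] at hb'
    have hB := P.isBelief_policyBelief hb'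
    have hae := P.ae_outLaw_policyBelief hb'
    -- Minimality of `S` is available only at belief states, which is why mass one is carried
    -- through the induction.
    have hB' := hB
    rw [policyBelief_twoStepPolicy] at hB'
    have hmin : P.bellmanObjective (P.costToGo t (k + 1)) (P.beliefOf S k z)
        (S k (P.beliefOf S k z)) ≤ P.costToGo (t + 1) k (P.beliefOf S k z) := by
      refine le_iInf fun a => ?_
      have := hS k hk _ hB' a
      unfold value at this
      rwa [ht] at this
    refine le_trans (add_le_add (add_le_add ?_ ?_) ?_) hmin
    · rw [P.stageDistortion_eq]
      refine le_iInf fun v => ?_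
      have e1 : ∀ x, ∫⁻ v, (P.distortion x v : ℝ≥0∞)
          ∂((ReconPolicy.ofFun g hg).kernel k (Fin.snoc z (Sum.inl x), r)) = 0 := by
        intro x
        have hx : Measurable fun v => (P.distortion x v : ℝ≥0∞) :=
          P.measurable_distortion_coe.comp measurable_prodMk_left
        rw [ReconPolicy.ofFun, Kernel.deterministic_apply, lintegral_dirac' _ hx,
          (hopt k hk z).1 x, P.distortion_self]
        rfl
      simp only [e1, mul_zero, lintegral_zero, zero_add]
      have hm : Measurable fun p : E × BeliefPoint E F k =>
          (P.distortion p.2.1 p.1 : ℝ≥0∞) *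
            ((S k (P.beliefOf S k z)).prob false p.2.1 p.2.2.1 * P.beliefOf S k z p.2) :=
        (P.measurable_distortion_coe.comp (measurable_snd.fst.prodMk measurable_fst)).mul
          ((measurable_prob_mul hB'.1 _ false).comp measurable_snd)
      have hd : Measurable fun v => P.distLoss (P.beliefOf S k z) (S k (P.beliefOf S k z)) v :=
        hm.lintegral_prod_right'
      rw [policyBelief_twoStepPolicy, collection_twoStepPolicy, ReconPolicy.ofFun,
        Kernel.deterministic_apply, lintegral_dirac' _ hd]
      exact (hopt k hk z).2 v
    · rw [P.infoLoss_eq hB', policyBelief_twoStepPolicy, collection_twoStepPolicy]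
    · rw [policyBelief_twoStepPolicy, collection_twoStepPolicy] at hae ⊢
      refine lintegral_mono_ae ?_
      -- For almost every sample the updated belief again has mass one, as the induction hypothesis
      -- demands.
      filter_upwards [hae] with s hs
      rw [policyBelief_twoStepPolicy] at hs
      have e : P.beliefOf S (k + 1) (Fin.snoc z s) =
          P.update (P.beliefOf S k z) (S k (P.beliefOf S k z)) s := by simp [beliefOf]
      rw [← e]
      refine (lintegral_mono fun v => ih (by omega) (Fin.snoc r v) hs).trans ?_
      simp

end TwoStep

end Model

end PrivacySampling

end

theorem mainTheorem2 {E F : Type*} [MeasurableSpace E] [StandardBorelSpace E]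
    [MeasurableSpace F] [StandardBorelSpace F] (P : PrivacySampling.Model E F)
    (S : ∀ k, PrivacySampling.Belief E F k → PrivacySampling.Collection E k)
    (hS : P.IsBellmanSolution S) (hmeas : P.IsMeasurableSelection S)
    (g : ∀ k : ℕ, PrivacySampling.Data E (k + 1) → E) (hg : ∀ k, Measurable (g k))
    (hopt : P.IsOptimalRecon S g) :
    (∀ (π : PrivacySampling.SamplingPolicy E) (ρ : PrivacySampling.ReconPolicy E),
      P.objective (P.twoStepPolicy S hmeas) (PrivacySampling.ReconPolicy.ofFun g hg) ≤
        P.objective π ρ) ∧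
    (∀ ρ : PrivacySampling.ReconPolicy E, ∀ k ≤ P.horizon,
      P.IsConditionalDensity (P.twoStepPolicy S hmeas) ρ k (P.beliefOf S k)) := by
  constructor
  · intro π ρ
    rw [P.objective_eq, P.objective_eq]
    -- No data exist at time zero, so both costs are compared with the same constant, integrated
    -- against two probability measures.
    calc _ ≤ ∫⁻ _, P.costToGo (P.horizon + 1) 0 P.initBelief
          ∂(P.law (P.twoStepPolicy S hmeas) (PrivacySampling.ReconPolicy.ofFun g hg) 0) := by
          refine MeasureTheory.lintegral_mono_ae ?_
          filter_upwards [(P.isBeliefAt (P.twoStepPolicy S hmeas)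
            (PrivacySampling.ReconPolicy.ofFun g hg) 0).ae_lintegral_eq_one] with h hh
          exact PrivacySampling.Model.policyCost_twoStepPolicy_le hmeas hS hg hopt
            (t := P.horizon + 1) (k := 0) rfl _ hh
      _ = ∫⁻ _, P.costToGo (P.horizon + 1) 0 P.initBelief ∂(P.law π ρ 0) := by simp
      _ ≤ _ := by
          refine MeasureTheory.lintegral_mono_ae ?_
          filter_upwards [(P.isBeliefAt π ρ 0).ae_lintegral_eq_one] with h hh
          exact P.costToGo_le_policyCost (π := π) (ρ := ρ) (P.horizon + 1) _ hh
  · intro ρ k _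
    -- The belief recursion of the two-step policy is `beliefOf`, and the conditional density
    -- property holds for every reconstruction policy.
    have h := P.isConditionalDensity_policyBelief (P.twoStepPolicy S hmeas) ρ k
    have e : P.policyBelief (P.twoStepPolicy S hmeas) k = P.beliefOf S k :=
      funext fun z => PrivacySampling.Model.policyBelief_twoStepPolicy hmeas k z
    rwa [e] at h
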